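/- Let $x_{d,j}$ ($d,j\ge 1$) be variables, and for a symmetric function $f$ over $\mathbb{Q}$ let $f(\mathbf{x}_{d*})$ be $f$ in the variables $x_{d,1},x_{d,2},\ldots$. A \emph{block} $d^m$ is a pair of positive integers $(d,m)$; blocks are ordered lexicographically. A \emph{type} $\tau$ of weight $n$ (written $\tau\Vdash n$) is a weakly decreasing finite sequence of blocks $(d_1^{m_1},\ldots,d_s^{m_s})$ with $\sum_i d_im_i=n$; $\tau|_d$ is the partition formed by the multiplicities of the blocks of $\tau$ of degree $d$. Let $s_\lambda=\sum_\mu K_{\lambda,\mu}m_\mu$ be the Schur functions and put $$s^{\otimes}_\tau=\prod_{d\ge1}s_{\tau|_d}(\mathbf{x}_{d*}),\qquad P_d=\sum_{k\mid d}k\sum_{j\ge1}x_{k,j}^{d/k},\qquad P_{d^m}=P_d(\mathbf{x}_{**}^m),\qquad P_\delta=\prod_{i=1}^sP_{d_i^{m_i}}$$ for a sequence of blocks $\delta=(d_1^{m_1},\ldots,d_s^{m_s})$, where $P_d(\mathbf{x}_{**}^m)$ is obtained from $P_d$ by replacing every variable by its $m$-th power. For partitions $\mu\subseteq\nu$, the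 skew shape $\nu/\mu$ is an \emph{$r$-ribbon} if it consists of $r$ boxes that can be labeled $b_1,\ldots,b_r$ so that, for $1<i\le r$, $b_i$ is one unit left of or one unit below $b_{i-1}$; its sign is $(-1)^{q-1}$, where $q$ is the number of rows it meets. A type $\tau$ \emph{arises from $\sigma$ by adding a ribbon $R$ for the block $d^m$} if for some $k\mid d$ the skew shape $R=\tau|_k/\sigma|_k$ is a $(dm/k)$-ribbon and $\tau|_j=\sigma|_j$ for all $j\ne k$; then $k$ is unique, and $\mathrm{wt}(R)=k$. A \emph{tensor rim hook tableau} (TRHT) of shape $\tau/\sigma$ and content $\delta=(d_1^{m_1},\ldots,d_s^{m_s})$ is a sequence of types $\sigma=\tau^0,\tau^1,\ldots,\tau^s=\tau$ such that $\tau^i$ arises from $\tau^{i-1}$ by adding a ribbon for $d_i^{m_i}$, for $1\le i\le s$. Its sign and weight are the products of the signs and of the weights of its ribbons. Let $\mathrm{TRHT}(\tau/\sigma,\delta)$ be the finite set of such objects, written $\mathrm{TRHT}(\tau,\delta)$ when $\sigma$ is the empty type. The family $\{s^{\otimes}_\tau\}$, with $\tau$ ranging over all types, is linearly independent over $\mathbb{Q}$,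 and the following hold. (1) For any type $\sigma$ and block $d^m$, $$s^{\otimes}_\sigma P_{d^m}=\sum_\tau\mathrm{sgn}(R)\,\mathrm{wt}(R)\,s^{\otimes}_\tau,$$ a finite sum over the types $\tau$ that arise from $\sigma$ by adding a ribbon $R$ for $d^m$. (2) For any type $\sigma$ and finite sequence of blocks $\delta$, $$s^{\otimes}_\sigma P_\delta=\sum_\tau\Bigl[\sum_{T\in\mathrm{TRHT}(\tau/\sigma,\delta)}\mathrm{sgn}(T)\,\mathrm{wt}(T)\Bigr]s^{\otimes}_\tau,$$ where only finitely many types $\tau$ have $\mathrm{TRHT}(\tau/\sigma,\delta)\neq\varnothing$. (3) For every $n\ge0$, the transition matrix $\mathcal{M}(P,s^{\otimes})$, i.e. the unique rational matrix with rows and columns indexed by the types of weight $n$ such that $P_\sigma=\sum_{\tau\Vdash n}\mathcal{M}(P,s^{\otimes})_{\tau,\sigma}\,s^{\otimes}_\tau$ for all $\sigma\Vdash n$, is given by $$\mathcal{M}(P,s^{\otimes})_{\tau,\sigma}=\sum_{T\in\mathrm{TRHT}(\tau,\sigma)}\mathrm{sgn}(T)\,\mathrm{wt}(T).$$ -/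

import Mathlib

open Finset

noncomputable section

namespace Polysym

/-! ### Blocks and splitting types -/

/-- A block `d^m` is a pair of positive integers `(d, m)`. Blocks are ordered lexicographically. -/
abbrev Block : Type := ℕ+ ×ₗ ℕ+

/-- The degree `d` of the block `d^m`. -/
def Block.deg (b : Block) : ℕ+ := (ofLex b).1

/-- The multiplicity `m` of the block `d^m`. -/
def Block.mult (b : Block) : ℕ+ := (ofLex b).2

/-- The weight `d * m` of the block `d^m`. -/
def Block.weight (b : Block) : ℕ := b.deg * b.mult

/-- A (splitting) type is a weakly decreasing finite sequence of blocks. -/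
@[ext]
structure SplitType where
  blocks : List Block
  sorted : blocks.SortedGE

namespace SplitType

/-- The empty type. -/
def empty : SplitType := ⟨[], List.Pairwise.nil.sortedGE⟩

/-- The weight `d₁ m₁ + ⋯ + dₛ mₛ` of a type. -/
def weight (τ : SplitType) : ℕ := (τ.blocks.map Block.weight).sum

/-- The finite set of degrees of the blocks of a type. -/
def degrees (τ : SplitType) : Finset ℕ+ := (τ.blocks.map Block.deg).toFinset

/-- The multiplicities of the blocks of degree `d` of a type, in weakly decreasing order. -/
def multList (τ : SplitType) (d : ℕ+) : List ℕ :=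
  (τ.blocks.filter (fun b => b.deg = d)).map (fun b => (b.mult : ℕ))

theorem multList_sorted (τ : SplitType) (d : ℕ+) : (τ.multList d).SortedGE := by
  apply List.Pairwise.sortedGE
  unfold multList
  rw [List.pairwise_map]
  have h := (τ.sorted.pairwise).filter (fun b => decide (b.deg = d))
  refine List.Pairwise.imp_of_mem ?_ h
  intro a b ha hb hab
  have ha' : a.deg = d := by simpa using (List.mem_filter.1 ha).2
  have hb' : b.deg = d := by simpa using (List.mem_filter.1 hb).2
  have hab' : b ≤ a := hab
  rw [Prod.Lex.le_iff] at hab'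
  have hd : (ofLex a).1 = (ofLex b).1 := ha'.trans hb'.symm
  rcases hab' with h1 | h1
  · exact absurd hd.symm h1.ne
  · exact_mod_cast h1.2

/-- `τ.restr d` is the partition `τ|_d` formed by the multiplicities of the blocks of degree `d`,
given by its Young diagram (whose cell `(i, j)` lies in row `i` and column `j`, both counted
from `0`). -/
def restr (τ : SplitType) (d : ℕ+) : YoungDiagram :=
  YoungDiagram.ofRowLens (τ.multList d) (τ.multList_sorted d)

end SplitType

/-! ### Symmetric functions -/

/-- The monomial symmetric function `m_μ` in the variables `x_0, x_1, …`: the sum of all monomials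
whose nonzero exponents are, in some order, the parts of `μ`. -/
def monomialSymm {n : ℕ} (μ : n.Partition) : MvPowerSeries ℕ ℚ := fun e =>
  open Classical in if e.support.val.map e = μ.parts then 1 else 0

/-- The power sum `p_r = x_0 ^ r + x_1 ^ r + ⋯` (for `r > 0`). -/
def powerSum (r : ℕ) : MvPowerSeries ℕ ℚ := fun e =>
  open Classical in if ∃ j : ℕ, e = Finsupp.single j r then 1 else 0

/-- The Kostka number `K_{lam, μ}`: the number of semistandard Young tableaux of shape `lam` and
content `μ`, i.e. such that the number of entries equal to `i` is the `i`-th part of `μ`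
(entries and parts being counted from `0`). -/
def kostka (lam : YoungDiagram) {n : ℕ} (μ : n.Partition) : ℕ :=
  Nat.card {T : SemistandardYoungTableau lam //
    ∀ i : ℕ, #{c ∈ lam.cells | T c.1 c.2 = i} = (μ.parts.sort (· ≥ ·)).getD i 0}

/-- The Schur function `s_lam = ∑_μ K_{lam, μ} m_μ`, the sum being over the partitions `μ` of
`|lam|`. -/
def schur (lam : YoungDiagram) : MvPowerSeries ℕ ℚ :=
  ∑ μ : lam.card.Partition, (kostka lam μ : ℚ) • monomialSymm μ

/-! ### Polysymmetric functions

They live in the ring of formal power series over `ℚ` in the variables `x_{d,j}`. -/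

/-- Formal power series over `ℚ` in the variables `x_{d,j}`, where `d ≥ 1` and `j ≥ 0`. -/
abbrev PolySeries : Type := MvPowerSeries (ℕ+ × ℕ) ℚ

/-- `f ↦ f(x_{d*})`: replace the variables `x_0, x_1, …` by `x_{d,0}, x_{d,1}, …`. -/
def inAlphabet (d : ℕ+) (f : MvPowerSeries ℕ ℚ) : PolySeries :=
  MvPowerSeries.rename (Function.Embedding.sectR d ℕ) f

/-- `s⊗_τ = ∏_d s_{τ|_d}(x_{d*})`; a degree `d` that is not the degree of a block of `τ` would
contribute the factor `s_∅ = 1`. -/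
def sTensor (τ : SplitType) : PolySeries :=
  ∏ d ∈ τ.degrees, inAlphabet d (schur (τ.restr d))

/-- `P_d = ∑_{k ∣ d} k ∑_j x_{k,j} ^ (d / k)`. -/
def polyP (d : ℕ+) : PolySeries :=
  open Classical in ∑ k ∈ Finset.Icc 1 d with k ∣ d, (k : ℚ) • inAlphabet k (powerSum ((d : ℕ) / (k : ℕ)))

/-- `P_{d^m} = P_d(x_{**}^m)`: every variable in `P_d` is replaced by its `m`-th power. -/
def polyPBlock (b : Block) : PolySeries :=
  MvPowerSeries.expand (b.mult : ℕ) b.mult.ne_zero (polyP b.deg)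

/-- `P_δ = ∏_i P_{d_i^{m_i}}` for a sequence `δ` of blocks. -/
def polyPSeq (δ : List Block) : PolySeries := (δ.map polyPBlock).prod

/-! ### Ribbons -/

/-- The skew shape `ν/μ` is an `r`-ribbon: `μ ⊆ ν`, and the cells of `ν` outside `μ` can be labeled
`b₁, …, b_r` (without repetition) such that each `b_i` with `i > 1` is one unit to the left of
`b_{i-1}` or one unit below `b_{i-1}`. -/
def IsRibbon (r : ℕ) (μ ν : YoungDiagram) : Prop :=
  μ ≤ ν ∧ ∃ L : List (ℕ × ℕ), L.length = r ∧ L.Nodup ∧ L.toFinset = ν.cells \ μ.cells ∧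
    L.IsChain (fun a b => (b.1 = a.1 ∧ b.2 + 1 = a.2) ∨ (b.1 = a.1 + 1 ∧ b.2 = a.2))

/-- The sign `(-1)^(r-1)` of the ribbon `ν/μ`, where `r` is the number of rows that it meets. -/
def ribbonSign (μ ν : YoungDiagram) : ℤ :=
  (-1) ^ (#((ν.cells \ μ.cells).image Prod.fst) - 1)

/-- The type `τ` arises from the type `σ` by adding a `(d m / k)`-ribbon to `dg(σ|_k)` for some
`k` dividing `d`, where `d^m = b`. The position `k` is recorded; it is determined by `σ` and `τ`
(see the `Subsingleton` instance below). -/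
@[ext]
structure RibbonAddition (σ τ : SplitType) (b : Block) where
  pos : ℕ+
  dvd : pos ∣ b.deg
  ribbon : IsRibbon (b.weight / pos) (σ.restr pos) (τ.restr pos)
  same : ∀ j : ℕ+, j ≠ pos → τ.restr j = σ.restr j

/-- The sign of the added ribbon. -/
def RibbonAddition.sgn {σ τ : SplitType} {b : Block} (R : RibbonAddition σ τ b) : ℤ :=
  ribbonSign (σ.restr R.pos) (τ.restr R.pos)

/-- The weight of the added ribbon: its position in the tensor diagram. -/
def RibbonAddition.wt {σ τ : SplitType} {b : Block} (R : RibbonAddition σ τ b) : ℤ := (R.pos : ℕ)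

/-- Tensor rim hook tableaux of shape `τ/σ` and content `δ = (b₁, …, bₛ)`: sequences of types
`σ = τ⁰, τ¹, …, τˢ = τ` such that `τⁱ` arises from `τⁱ⁻¹` by a ribbon addition for the
block `bᵢ`. -/
inductive TRHT : SplitType → SplitType → List Block → Type
  | nil (σ : SplitType) : TRHT σ σ []
  | cons {σ ρ τ : SplitType} {b : Block} {δ : List Block}
      (R : RibbonAddition σ ρ b) (T : TRHT ρ τ δ) : TRHT σ τ (b :: δ)

/-- The sign of a tensor rim hook tableau: the product of the signs of its ribbons. -/
def TRHT.sgn : {σ τ : SplitType} → {δ : List Block} → TRHT σ τ δ → ℤ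
  | _, _, _, .nil _ => 1
  | _, _, _, .cons R T => R.sgn * T.sgn

/-- The weight of a tensor rim hook tableau: the product of the weights of its ribbons. -/
def TRHT.wt : {σ τ : SplitType} → {δ : List Block} → TRHT σ τ δ → ℤ
  | _, _, _, .nil _ => 1
  | _, _, _, .cons R T => R.wt * T.wt

/-! ### Finiteness of the index sets of the sums -/

theorem IsRibbon.card_add {r : ℕ} {μ ν : YoungDiagram} (h : IsRibbon r μ ν) :
    ν.card = μ.card + r := by
  obtain ⟨hle, L, hL, hnd, hset, -⟩ := h
  have hc : #(ν.cells \ μ.cells) = r := by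
    rw [← hset, List.toFinset_card_of_nodup hnd, hL]
  have := Finset.card_sdiff_add_card_eq_card (YoungDiagram.cells_subset_iff.2 hle)
  simp only [YoungDiagram.card]
  omega

theorem Block.weight_div_pos {b : Block} {k : ℕ+} (h : k ∣ b.deg) : 0 < b.weight / (k : ℕ) := by
  apply Nat.div_pos _ k.pos
  exact (Nat.le_of_dvd b.deg.pos (PNat.dvd_iff.1 h)).trans
    (Nat.le_mul_of_pos_right _ b.mult.pos)

instance RibbonAddition.instSubsingleton (σ τ : SplitType) (b : Block) :
    Subsingleton (RibbonAddition σ τ b) := by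
  refine ⟨fun R R' => ?_⟩
  ext1
  by_contra hne
  have h1 := R.ribbon.card_add
  rw [R'.same _ hne] at h1
  exact absurd (Nat.add_eq_left.1 h1.symm) (Block.weight_div_pos R.dvd).ne'

instance RibbonAddition.instFintype (σ τ : SplitType) (b : Block) :
    Fintype (RibbonAddition σ τ b) := Fintype.ofFinite _

theorem card_ofRowLens (w : List ℕ) (hw : w.SortedGE) :
    (YoungDiagram.ofRowLens w hw).card = w.sum := by
  change #(YoungDiagram.cellsOfRowLens w) = w.sum
  clear hw
  induction w with
  | nil => rfl
  | cons a w ih =>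
    rw [YoungDiagram.cellsOfRowLens, Finset.card_union_of_disjoint, Finset.card_map, ih]
    · simp
    · rw [Finset.disjoint_left]
      rintro ⟨i, j⟩ h1 h2
      simp at h1 h2
      omega

theorem sum_map_eq_sum_filter (l : List Block) (S : Finset ℕ+) (hS : ∀ b ∈ l, b.deg ∈ S) :
    (l.map Block.weight).sum = ∑ d ∈ S, (d : ℕ) *
      ((l.filter (fun b => b.deg = d)).map (fun b => (b.mult : ℕ))).sum := by
  induction l with
  | nil => simp
  | cons b l ih =>
    rw [List.map_cons, List.sum_cons, ih (fun c hc => hS c (List.mem_cons_of_mem _ hc))]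
    have hb : b.weight = ∑ d ∈ S, if b.deg = d then (d : ℕ) * b.mult else 0 := by
      rw [Finset.sum_ite_eq, if_pos (hS b List.mem_cons_self)]
      rfl
    rw [hb, ← Finset.sum_add_distrib]
    refine Finset.sum_congr rfl fun d _ => ?_
    by_cases h : b.deg = d <;> simp [h, mul_add]

theorem SplitType.weight_eq (τ : SplitType) (S : Finset ℕ+) (hS : τ.degrees ⊆ S) :
    τ.weight = ∑ d ∈ S, (d : ℕ) * (τ.restr d).card := by
  rw [SplitType.weight, sum_map_eq_sum_filter τ.blocks S]
  · refine Finset.sum_congr rfl fun d _ => ?_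
    rw [SplitType.restr, card_ofRowLens]
    rfl
  · intro b hb
    apply hS
    rw [SplitType.degrees, List.mem_toFinset]
    exact List.mem_map_of_mem hb

theorem RibbonAddition.weight_le {σ τ : SplitType} {b : Block} (R : RibbonAddition σ τ b) :
    σ.weight ≤ τ.weight := by
  rw [σ.weight_eq _ Finset.subset_union_left, τ.weight_eq (σ.degrees ∪ τ.degrees)
    Finset.subset_union_right]
  refine Finset.sum_le_sum fun d _ => Nat.mul_le_mul_left _ ?_
  by_cases h : d = R.pos
  · subst h
    rw [R.ribbon.card_add]
    exact Nat.le_add_right _ _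
  · rw [R.same d h]

theorem TRHT.weight_le {σ τ : SplitType} {δ : List Block} (T : TRHT σ τ δ) :
    σ.weight ≤ τ.weight := by
  induction T with
  | nil => exact le_rfl
  | cons R _ ih => exact R.weight_le.trans ih

theorem SplitType.finite_weight_le (n : ℕ) : {τ : SplitType | τ.weight ≤ n}.Finite := by
  let g : Block → Fin (n + 1) × Fin (n + 1) := fun b => (Fin.ofNat _ b.deg, Fin.ofNat _ b.mult)
  have hb : ∀ τ : SplitType, τ.weight ≤ n → ∀ b ∈ τ.blocks, (b.deg : ℕ) ≤ n ∧ (b.mult : ℕ) ≤ n := by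
    intro τ hτ b hb
    have h1 : b.weight ≤ n :=
      (List.le_sum_of_mem (List.mem_map_of_mem (f := Block.weight) hb)).trans hτ
    exact ⟨(Nat.le_mul_of_pos_right _ b.mult.pos).trans h1,
      (Nat.le_mul_of_pos_left _ b.deg.pos).trans h1⟩
  refine Set.Finite.of_finite_image (f := fun τ : SplitType => τ.blocks.map g) ?_ ?_
  · refine (List.finite_length_le (Fin (n + 1) × Fin (n + 1)) n).subset ?_
    rintro _ ⟨τ, hτ, rfl⟩
    have : τ.blocks.length ≤ τ.weight := by
      rw [SplitType.weight, ← List.length_map (f := Block.weight)]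
      apply List.length_le_sum_of_one_le
      intro i hi
      obtain ⟨b, -, rfl⟩ := List.mem_map.1 hi
      exact Nat.mul_pos b.deg.pos b.mult.pos
    simpa using this.trans hτ
  · intro τ hτ ρ hρ h
    ext1
    have hg : ∀ a : Block, (a.deg : ℕ) ≤ n ∧ (a.mult : ℕ) ≤ n →
        ∀ c : Block, (c.deg : ℕ) ≤ n ∧ (c.mult : ℕ) ≤ n → g a = g c → a = c := by
      intro a ha c hc hac
      have h1 := congrArg (fun x => (x.1 : ℕ)) hac
      have h2 := congrArg (fun x => (x.2 : ℕ)) hac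
      simp only [g, Fin.val_ofNat] at h1 h2
      rw [Nat.mod_eq_of_lt (by omega), Nat.mod_eq_of_lt (by omega)] at h1 h2
      exact ofLex.injective (Prod.ext (PNat.coe_injective h1) (PNat.coe_injective h2))
    have key : ∀ l l' : List Block, (∀ a ∈ l, (a.deg : ℕ) ≤ n ∧ (a.mult : ℕ) ≤ n) →
        (∀ a ∈ l', (a.deg : ℕ) ≤ n ∧ (a.mult : ℕ) ≤ n) → l.map g = l'.map g → l = l' := by
      intro l
      induction l with
      | nil =>
        intro l' _ _ h
        simpa using h.symm
      | cons a l ih =>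
        intro l' ha hl' h
        cases l' with
        | nil => simp at h
        | cons c l' =>
          rw [List.map_cons, List.map_cons, List.cons.injEq] at h
          rw [hg a (ha a List.mem_cons_self) c (hl' c List.mem_cons_self) h.1,
            ih l' (fun x hx => ha x (List.mem_cons_of_mem _ hx))
              (fun x hx => hl' x (List.mem_cons_of_mem _ hx)) h.2]
    exact key _ _ (hb τ hτ) (hb ρ hρ) h

instance TRHT.instFinite (σ τ : SplitType) (δ : List Block) : Finite (TRHT σ τ δ) := by
  induction δ generalizing σ with
  | nil =>
    have : Subsingleton (TRHT σ τ []) := ⟨fun T T' => by cases T; cases T'; rfl⟩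
    infer_instance
  | cons b δ ih =>
    have hfin : Finite {ρ : SplitType // ρ.weight ≤ τ.weight} :=
      (SplitType.finite_weight_le τ.weight).to_subtype
    refine Finite.of_surjective
      (α := Σ ρ : {ρ : SplitType // ρ.weight ≤ τ.weight},
        RibbonAddition σ ρ b × TRHT ρ τ δ) (fun x => TRHT.cons x.2.1 x.2.2) ?_
    intro T
    cases T with
    | cons R T => exact ⟨⟨⟨_, T.weight_le⟩, R, T⟩, rfl⟩

instance TRHT.instFintype (σ τ : SplitType) (δ : List Block) : Fintype (TRHT σ τ δ) :=
  Fintype.ofFinite _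

/-- The types of weight `n`. -/
abbrev TypesOf (n : ℕ) : Type := {τ : SplitType // τ.weight = n}

instance TypesOf.instFintype (n : ℕ) : Fintype (TypesOf n) :=
  have : Finite (TypesOf n) :=
    ((SplitType.finite_weight_le n).subset fun _ h => le_of_eq h).to_subtype
  Fintype.ofFinite _

/-- `M` is the transition matrix `M(F, G)` in weight `n`: the unique matrix, with rows and columns
indexed by the types of weight `n`, such that `F_σ = ∑_τ M_{τ,σ} G_τ` for all `σ`. -/
def IsTransitionMatrix (n : ℕ) (F G : SplitType → PolySeries)
    (M : Matrix (TypesOf n) (TypesOf n) ℚ) : Prop :=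
  (∀ σ : TypesOf n, F σ = ∑ τ : TypesOf n, M τ σ • G τ) ∧
    ∀ M' : Matrix (TypesOf n) (TypesOf n) ℚ,
      (∀ σ : TypesOf n, F σ = ∑ τ : TypesOf n, M' τ σ • G τ) → M' = M

end Polysym

end

noncomputable section

namespace Polysym

/-! ### Young diagrams and their row lengths -/

/-! The alphabets of different degrees are independent. Since `P_{d^m}` is the sum over `k ∣ d` of
`k` times the power sum `p_{dm/k}` in the alphabet of degree `k` (`polyPBlock_eq`), each of its
terms acts on a single Schur factor of `s⊗_σ`, and the classical Murnaghan–Nakayama rule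
(`schur_mul_powerSum`) expands that product. This is the rule for one block. Iterating it gives the
rule for a sequence of blocks, and starting from the empty type gives the transition matrix, because
ribbons for `d^m` raise the weight by exactly `d * m`. Uniqueness of the matrix is linear
independence.

The Murnaghan–Nakayama rule is proved with alternants in `n` variables, `n` large. The bialternant
formula `tabSum_mul_alt` says that a Schur polynomial times the Vandermonde determinant is the
alternant with exponents `λ_i + n - 1 - i`. Multiplying an alternant by `p_r` raises one exponent by
`r`, in all possible ways. If the raised exponent collides with another one, the alternant vanishes.
Otherwise, sorting the exponents moves the raised row `b` up to some row `a` and the rows `a, …, b -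
1` down by one; this is a cycle of sign `(-1)^(b-a)`, and on diagrams it is the addition of an
`r`-ribbon in the rows `a, …, b` (`IsRimMove`). The bialternant formula itself holds because both
sides obey the same branching recursion in the last variable (`alt_succ`, `tabSum_succ`).

Schur functions are defined through Kostka numbers, hence through contents that are partitions.
Their coefficients at arbitrary monomials count tableaux because Schur polynomials are symmetric
(`tabSum_perm`), again by the bialternant formula.

Linear independence is triangularity for the dominance order: the monomial of `τ` occurs in `s⊗_τ`,
and otherwise only in `s⊗_σ` with `σ` dominating `τ`. -/

theorem ext_rowLen {μ ν : YoungDiagram} (h : ∀ i, μ.rowLen i = ν.rowLen i) : μ = ν := by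
  refine SetLike.ext fun c => ?_
  rw [← Prod.mk.eta (p := c), YoungDiagram.mem_iff_lt_rowLen, YoungDiagram.mem_iff_lt_rowLen, h]

theorem le_iff_rowLen {μ ν : YoungDiagram} : μ ≤ ν ↔ ∀ i, μ.rowLen i ≤ ν.rowLen i := by
  constructor
  · intro h i
    by_contra! hlt
    have := h (YoungDiagram.mem_iff_lt_rowLen.2 hlt)
    exact lt_irrefl _ (YoungDiagram.mem_iff_lt_rowLen.1 this)
  · rintro h ⟨i, j⟩ hc
    exact YoungDiagram.mem_iff_lt_rowLen.2
      ((YoungDiagram.mem_iff_lt_rowLen.1 hc).trans_le (h i))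

theorem mem_cells_iff_lt_rowLen {μ : YoungDiagram} {c : ℕ × ℕ} :
    c ∈ μ.cells ↔ c.2 < μ.rowLen c.1 := by
  rw [YoungDiagram.mem_cells, ← Prod.mk.eta (p := c), YoungDiagram.mem_iff_lt_rowLen]

/-- The Young diagram with at most `n` rows and prescribed row lengths. -/
def diagramOfFun (n : ℕ) (f : ℕ → ℕ) (hf : Antitone f) : YoungDiagram where
  cells := (range n ×ˢ range (f 0)).filter fun c => c.2 < f c.1
  isLowerSet := by
    rintro ⟨i, j⟩ ⟨i', j'⟩ ⟨hi, hj⟩ h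
    simp only [coe_filter, mem_product, mem_range, Set.mem_ofPred_eq] at h hi hj ⊢
    have := hf hi
    omega

theorem rowLen_diagramOfFun {n : ℕ} {f : ℕ → ℕ} (hf : Antitone f) (h0 : ∀ i, n ≤ i → f i = 0)
    (i : ℕ) : (diagramOfFun n f hf).rowLen i = f i := by
  have key : ∀ j, j < (diagramOfFun n f hf).rowLen i ↔ j < f i := by
    intro j
    rw [← YoungDiagram.mem_iff_lt_rowLen, ← YoungDiagram.mem_cells]
    simp only [diagramOfFun, mem_filter, mem_product, mem_range]
    have := hf (Nat.zero_le i)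
    have := h0 i
    omega
  exact le_antisymm (le_of_forall_lt fun j hj => (key j).1 hj)
    (le_of_forall_lt fun j hj => (key j).2 hj)

theorem rowLen_eq_zero_of_le {μ : YoungDiagram} {n i : ℕ} (h : μ.rowLen n = 0) (hi : n ≤ i) :
    μ.rowLen i = 0 :=
  Nat.le_zero.1 (h ▸ μ.rowLen_anti n i hi)

theorem card_eq_sum_rowLen {μ : YoungDiagram} {n : ℕ} (h : μ.rowLen n = 0) :
    μ.card = ∑ i ∈ range n, μ.rowLen i := by
  have : μ.cells = ((range n).sigma fun i => range (μ.rowLen i)).map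
      (Equiv.sigmaEquivProd ℕ ℕ).toEmbedding := by
    ext ⟨i, j⟩
    simp only [mem_cells_iff_lt_rowLen, mem_map_equiv, mem_sigma, mem_range]
    refine ⟨fun hj => ⟨?_, hj⟩, fun hj => hj.2⟩
    by_contra! hi
    change n ≤ i at hi
    have h0 := rowLen_eq_zero_of_le h hi
    change j < μ.rowLen i at hj
    omega
  rw [YoungDiagram.card, this, card_map, card_sigma]
  simp

theorem rowLen_card (μ : YoungDiagram) : μ.rowLen μ.card = 0 := by
  by_contra h
  have hsub : (range (μ.card + 1)).image (fun i => (i, 0)) ⊆ μ.cells := by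
    intro c hc
    obtain ⟨i, hi, rfl⟩ := mem_image.1 hc
    rw [mem_cells_iff_lt_rowLen]
    have := μ.rowLen_anti i μ.card (by rw [mem_range] at hi; omega)
    dsimp only
    omega
  have := card_le_card hsub
  rw [card_image_of_injective _ (Prod.mk_left_injective 0), card_range] at this
  change μ.card + 1 ≤ μ.card at this
  omega

theorem rowLen_eq_zero_of_card_le {μ : YoungDiagram} {i : ℕ} (h : μ.card ≤ i) : μ.rowLen i = 0 :=
  rowLen_eq_zero_of_le (rowLen_card μ) h

theorem rowLen_le_card (μ : YoungDiagram) (i : ℕ) : μ.rowLen i ≤ μ.card := by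
  rw [YoungDiagram.rowLen_eq_card, YoungDiagram.card]
  exact card_le_card (filter_subset _ _)

theorem finite_card_le (N : ℕ) : {μ : YoungDiagram | μ.card ≤ N}.Finite := by
  have hinj : Function.Injective YoungDiagram.cells := fun μ ν h => by
    cases μ; cases ν; cases h; rfl
  refine Set.Finite.of_finite_image (f := YoungDiagram.cells) ?_ hinj.injOn
  refine ((range (N + 1) ×ˢ range (N + 1)).powerset.finite_toSet).subset ?_
  rintro _ ⟨μ, hμ, rfl⟩
  simp only [coe_powerset, Set.mem_preimage, Set.mem_powerset_iff, coe_subset]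
  intro c hc
  rw [mem_cells_iff_lt_rowLen] at hc
  have h1 := rowLen_le_card μ c.1
  have h2 : c.1 < μ.card := by
    by_contra! h
    rw [rowLen_eq_zero_of_card_le h] at hc
    omega
  simp only [Set.mem_ofPred_eq] at hμ
  simp only [mem_product, mem_range]
  omega

/-! ### Ribbons in terms of row lengths -/

/-- The row lengths `g` arise from `f` by adding a ribbon of `r` cells in the rows `a, …, b`. -/
structure IsRimMove (r a b : ℕ) (f g : ℕ → ℕ) : Prop where
  le : a ≤ b
  out : ∀ i, i < a ∨ b < i → g i = f i
  mid : ∀ i, a ≤ i → i < b → g (i + 1) = f i + 1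
  top : g a + b = f b + r + a

/-- One unit to the left, or one unit below. -/
def RibbonStep (a b : ℕ × ℕ) : Prop :=
  (b.1 = a.1 ∧ b.2 + 1 = a.2) ∨ (b.1 = a.1 + 1 ∧ b.2 = a.2)

theorem RibbonStep.pairwise {L : List (ℕ × ℕ)} (h : L.IsChain RibbonStep) :
    L.Pairwise fun x y => x.1 ≤ y.1 ∧ y.2 ≤ x.2 := by
  have : IsTrans (ℕ × ℕ) (fun x y => x.1 ≤ y.1 ∧ y.2 ≤ x.2) :=
    ⟨fun _ _ _ h1 h2 => ⟨h1.1.trans h2.1, h2.2.trans h1.2⟩⟩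
  refine (List.isChain_iff_pairwise (R := fun x y : ℕ × ℕ => x.1 ≤ y.1 ∧ y.2 ≤ x.2)).1
    (h.imp fun x y hxy => ?_)
  rcases hxy with h | h <;> omega

/-- Every step raises the row index minus the column index by one; the relation expresses this
without subtraction. -/
theorem RibbonStep.nodup {L : List (ℕ × ℕ)} (h : L.IsChain RibbonStep) : L.Nodup := by
  have : IsTrans (ℕ × ℕ) (fun x y => x.1 + y.2 < y.1 + x.2) :=
    ⟨fun _ _ _ h1 h2 => by omega⟩
  refine List.Pairwise.imp (R := fun x y => x.1 + y.2 < y.1 + x.2) ?_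
    ((List.isChain_iff_pairwise (R := fun x y : ℕ × ℕ => x.1 + y.2 < y.1 + x.2)).1
      (h.imp fun x y hxy => ?_))
  · rintro x y hxy rfl
    omega
  · rcases hxy with h | h <;> omega

/-- A ribbon that meets a row `≤ i` and a row `> i` steps down from the row `i`. -/
theorem RibbonStep.exists_split {L : List (ℕ × ℕ)} (h : L.IsChain RibbonStep) (i : ℕ)
    (h1 : ∃ x ∈ L, x.1 ≤ i) (h2 : ∃ y ∈ L, i < y.1) :
    ∃ L₁ j L₂, L = L₁ ++ (i, j) :: (i + 1, j) :: L₂ := by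
  induction L with
  | nil => simp at h1
  | cons p t ih =>
    obtain ⟨y, hy, hiy⟩ := h2
    obtain ⟨x, hx, hix⟩ := h1
    have hp : p.1 ≤ i := by
      have := RibbonStep.pairwise h
      rw [List.pairwise_cons] at this
      rcases List.mem_cons.1 hx with rfl | hx'
      · exact hix
      · exact (this.1 x hx').1.trans hix
    have hyt : y ∈ t := by
      rcases List.mem_cons.1 hy with rfl | hy'
      · omega
      · exact hy'
    by_cases hex : ∃ x ∈ t, x.1 ≤ i
    · obtain ⟨L₁, j, L₂, rfl⟩ := ih h.tail hex ⟨y, hyt, hiy⟩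
      exact ⟨p :: L₁, j, L₂, rfl⟩
    · push Not at hex
      cases t with
      | nil => simp at hyt
      | cons q t =>
        have hq := hex q List.mem_cons_self
        rw [List.isChain_cons_cons] at h
        obtain ⟨p1, p2⟩ := p
        obtain ⟨q1, q2⟩ := q
        have hs := h.1
        simp only [RibbonStep] at hs hq hp
        refine ⟨[], p2, t, ?_⟩
        have e1 : p1 = i := by omega
        have e2 : q1 = i + 1 := by omega
        have e3 : q2 = p2 := by omega
        subst e1 e2 e3
        rfl

/-- The cells `(i, f i), …, (i, g i - 1)`, from right to left. -/
theorem exists_row_list (i p k : ℕ) : ∃ L : List (ℕ × ℕ), L.IsChain RibbonStep ∧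
    (∀ c, c ∈ L ↔ c.1 = i ∧ p ≤ c.2 ∧ c.2 < p + (k + 1)) ∧ L.length = k + 1 ∧
    L.head? = some (i, p + k) ∧ L.getLast? = some (i, p) := by
  induction k with
  | zero =>
    refine ⟨[(i, p)], by simp, ?_, rfl, by simp, by simp⟩
    rintro ⟨c1, c2⟩
    simp only [List.mem_singleton, Prod.mk.injEq]
    omega
  | succ k ih =>
    obtain ⟨L, hch, hmem, hlen, hhd, hlast⟩ := ih
    refine ⟨(i, p + (k + 1)) :: L, ?_, ?_, by simp [hlen], by simp, ?_⟩
    · refine List.isChain_cons.2 ⟨?_, hch⟩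
      intro y hy
      rw [hhd] at hy
      cases hy
      left
      simp only [true_and]
      omega
    · rintro ⟨c1, c2⟩
      simp only [List.mem_cons, Prod.mk.injEq, hmem]
      omega
    · cases L with
      | nil => simp at hlen
      | cons q t => rw [List.getLast?_cons_cons]; exact hlast

/-- The rows are listed from top to bottom, each from right to left. By `hmid` the rightmost new
cell of row `i + 1` is directly below the leftmost new cell `(i, f i)` of row `i`, so the rows join
into a chain, and its length telescopes. The head is recorded for the gluing in the induction. -/
theorem exists_ribbon_list (f g : ℕ → ℕ) (k a : ℕ) (hlt : ∀ i, a ≤ i → i ≤ a + k → f i < g i)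
    (hmid : ∀ i, a ≤ i → i < a + k → g (i + 1) = f i + 1) :
    ∃ L : List (ℕ × ℕ), L.IsChain RibbonStep ∧
      (∀ c, c ∈ L ↔ a ≤ c.1 ∧ c.1 ≤ a + k ∧ f c.1 ≤ c.2 ∧ c.2 < g c.1) ∧
      L.length + f (a + k) = g a + k ∧ L.head? = some (a, g a - 1) := by
  induction k generalizing a with
  | zero =>
    obtain ⟨L, h1, h2, h3, h4, h5⟩ := exists_row_list a (f a) (g a - f a - 1)
    have := hlt a le_rfl le_rfl
    refine ⟨L, h1, ?_, ?_, ?_⟩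
    · rintro ⟨c1, c2⟩
      rw [h2]
      simp only [add_zero]
      constructor
      · rintro ⟨rfl, h⟩
        omega
      · rintro ⟨h, h', h''⟩
        obtain rfl : c1 = a := by omega
        omega
    · simp only [add_zero]
      omega
    · rw [h4]
      congr 2
      omega
  | succ k ih =>
    obtain ⟨L, h1, h2, h3, h4⟩ := ih (a + 1) (fun i h h' => hlt i (by omega) (by omega))
      (fun i h h' => hmid i (by omega) (by omega))
    have hk : a + 1 + k = a + (k + 1) := by omega
    rw [hk] at h2 h3
    obtain ⟨L', h1', h2', h3', h4', h5'⟩ := exists_row_list a (f a) (g a - f a - 1)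
    have hlta := hlt a le_rfl (by omega)
    have hm := hmid a le_rfl (by omega)
    refine ⟨L' ++ L, ?_, ?_, ?_, ?_⟩
    · rw [List.isChain_append]
      refine ⟨h1', h1, ?_⟩
      intro x hx y hy
      rw [h5'] at hx
      rw [h4] at hy
      cases hx
      cases hy
      right
      simp only [true_and]
      omega
    · rintro ⟨c1, c2⟩
      rw [List.mem_append, h2, h2']
      constructor
      · rintro (⟨h0, h⟩ | h)
        · simp only at h0 h ⊢
          subst h0
          omega
        · simp only at h ⊢
          omega
      · rintro ⟨h, h'⟩
        rcases eq_or_lt_of_le h with h'' | h''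
        · left
          simp only at h'' h' ⊢
          subst h''
          omega
        · right
          simp only at h'' h' ⊢
          omega
    · rw [List.length_append]
      omega
    · rw [List.head?_append_of_ne_nil, h4']
      · congr 2
        omega
      · rintro rfl
        simp at h3'

/-- For `i < b`, `f i + 1 = g (i + 1) ≤ g i`. For the last row, `g b = f (b - 1) + 1 > f b` if `a <
b`; if `a = b`, the row gains `r > 0` cells. -/
theorem IsRimMove.lt {r a b : ℕ} {f g : ℕ → ℕ} (hr : 0 < r) (hf : Antitone f) (hg : Antitone g)
    (h : IsRimMove r a b f g) : ∀ i, a ≤ i → i ≤ b → f i < g i := by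
  intro i hai hib
  rcases eq_or_lt_of_le hib with rfl | hlt
  · rcases eq_or_lt_of_le hai with rfl | hlt'
    · have := h.top
      omega
    · have h1 := h.mid (i - 1) (by omega) (by omega)
      have h2 := hf (Nat.sub_le i 1)
      have e : i - 1 + 1 = i := by omega
      rw [e] at h1
      omega
  · have h1 := h.mid i hai hlt
    have h2 := hg (Nat.le_succ i)
    simp only [Nat.succ_eq_add_one] at h2
    omega

theorem mem_sdiff_cells {μ ν : YoungDiagram} {c : ℕ × ℕ} :
    c ∈ ν.cells \ μ.cells ↔ μ.rowLen c.1 ≤ c.2 ∧ c.2 < ν.rowLen c.1 := by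
  rw [mem_sdiff, mem_cells_iff_lt_rowLen, mem_cells_iff_lt_rowLen, not_lt, and_comm]

theorem rowLen_antitone (μ : YoungDiagram) : Antitone μ.rowLen := fun i j h => μ.rowLen_anti i j h

theorem IsRimMove.mem_list_iff {r a b : ℕ} {μ ν : YoungDiagram}
    (h : IsRimMove r a b μ.rowLen ν.rowLen) (c : ℕ × ℕ) :
    (a ≤ c.1 ∧ c.1 ≤ b ∧ μ.rowLen c.1 ≤ c.2 ∧ c.2 < ν.rowLen c.1) ↔
      c ∈ ν.cells \ μ.cells := by
  rw [mem_sdiff_cells]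
  have := h.out c.1
  omega

theorem IsRimMove.isRibbon {r a b : ℕ} {μ ν : YoungDiagram} (hr : 0 < r)
    (h : IsRimMove r a b μ.rowLen ν.rowLen) : IsRibbon r μ ν := by
  have hlt := h.lt hr (rowLen_antitone μ) (rowLen_antitone ν)
  have hab := h.le
  refine ⟨le_iff_rowLen.2 fun i => ?_, ?_⟩
  · by_cases hi : i < a ∨ b < i
    · exact (h.out i hi).ge
    · exact (hlt i (by omega) (by omega)).le
  · obtain ⟨L, h1, h2, h3, -⟩ := exists_ribbon_list μ.rowLen ν.rowLen (b - a) a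
      (fun i h h' => hlt i h (by omega)) (fun i h' h'' => h.mid i h' (by omega))
    have e : a + (b - a) = b := by omega
    rw [e] at h2 h3
    refine ⟨L, ?_, RibbonStep.nodup h1, ?_, h1⟩
    · have := h.top
      omega
    · ext c
      rw [List.mem_toFinset, h2, h.mem_list_iff]

/-- Take for `a` and `b` the first and last rows met. Where the chain steps down from `(i, j)` to
`(i + 1, j)`, the columns decrease weakly along the chain, so `j` is the leftmost new column of row
`i` and the rightmost new column of row `i + 1`. -/
theorem IsRibbon.exists_isRimMove {r : ℕ} {μ ν : YoungDiagram} (hr : 0 < r)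
    (h : IsRibbon r μ ν) : ∃ a b, IsRimMove r a b μ.rowLen ν.rowLen := by
  obtain ⟨hle, L, hlen, hnd, hset, hch⟩ := h
  have hle' := le_iff_rowLen.1 hle
  have hch' : L.IsChain RibbonStep := hch
  have hmem : ∀ c, c ∈ L ↔ μ.rowLen c.1 ≤ c.2 ∧ c.2 < ν.rowLen c.1 := fun c => by
    rw [← mem_sdiff_cells, ← hset, List.mem_toFinset]
  have hne : (L.toFinset.image Prod.fst).Nonempty := by
    rw [image_nonempty, List.toFinset_nonempty_iff]
    rintro rfl
    simp at hlen
    omega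
  set a := (L.toFinset.image Prod.fst).min' hne with ha
  set b := (L.toFinset.image Prod.fst).max' hne with hb
  obtain ⟨ca, hca, hca'⟩ := mem_image.1 ((L.toFinset.image Prod.fst).min'_mem hne)
  obtain ⟨cb, hcb, hcb'⟩ := mem_image.1 ((L.toFinset.image Prod.fst).max'_mem hne)
  rw [List.mem_toFinset] at hca hcb
  have hab : a ≤ b := min'_le_max' _ hne
  have hrow : ∀ c ∈ L, a ≤ c.1 ∧ c.1 ≤ b := fun c hc =>
    ⟨min'_le _ _ (mem_image_of_mem _ (List.mem_toFinset.2 hc)),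
      le_max' _ _ (mem_image_of_mem _ (List.mem_toFinset.2 hc))⟩
  have hout : ∀ i, i < a ∨ b < i → ν.rowLen i = μ.rowLen i := by
    intro i hi
    by_contra hne'
    have := hrow (i, μ.rowLen i) ((hmem _).2 ⟨le_rfl, lt_of_le_of_ne (hle' i) (Ne.symm hne')⟩)
    dsimp only at this
    omega
  have hstep : ∀ i, a ≤ i → i < b → μ.rowLen i < ν.rowLen i ∧ ν.rowLen (i + 1) = μ.rowLen i + 1 ∧
      μ.rowLen (i + 1) < ν.rowLen (i + 1) := by
    intro i hai hib
    obtain ⟨L₁, j, L₂, hL⟩ := RibbonStep.exists_split hch' i ⟨ca, hca, by omega⟩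
      ⟨cb, hcb, by omega⟩
    have hpw := RibbonStep.pairwise hch'
    rw [hL, List.pairwise_append, List.pairwise_cons, List.pairwise_cons] at hpw
    have h1 := (hmem (i, j)).1 (by simp [hL])
    have h2 := (hmem (i + 1, j)).1 (by simp [hL])
    have h3 : j ≤ μ.rowLen i := by
      have h4 := (hmem (i, μ.rowLen i)).2 ⟨le_rfl, by dsimp only at h1 ⊢; omega⟩
      rw [hL, List.mem_append, List.mem_cons, List.mem_cons] at h4
      rcases h4 with h4 | h4 | h4 | h4
      · exact (hpw.2.2 _ h4 _ List.mem_cons_self).2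
      · simp only [Prod.mk.injEq, true_and] at h4
        exact h4.ge
      · simp at h4
      · have := (hpw.2.1.2.1 _ h4).1
        dsimp only at this
        omega
    have h5 : ν.rowLen (i + 1) ≤ j + 1 := by
      have h4 := (hmem (i + 1, ν.rowLen (i + 1) - 1)).2 (by dsimp only at h2 ⊢; omega)
      rw [hL, List.mem_append, List.mem_cons, List.mem_cons] at h4
      rcases h4 with h4 | h4 | h4 | h4
      · have := (hpw.2.2 _ h4 _ List.mem_cons_self).1
        dsimp only at this
        omega
      · simp at h4
      · simp only [Prod.mk.injEq, true_and] at h4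
        omega
      · have := (hpw.2.1.2.1 _ h4).2
        dsimp only at this
        omega
    dsimp only at h1 h2
    omega
  have hlt : ∀ i, a ≤ i → i ≤ b → μ.rowLen i < ν.rowLen i := by
    intro i hai hib
    rcases eq_or_lt_of_le hib with hib0 | hib'
    · rw [hib0]
      have := (hmem cb).1 hcb
      rw [hcb', ← hb] at this
      exact this.1.trans_lt this.2
    · exact (hstep i hai hib').1
  -- The row-by-row list enumerates the same cells as `L`, so its telescoped length is `r`, which
  -- gives the `top` equation.
  obtain ⟨L', h1, h2, h3, -⟩ := exists_ribbon_list μ.rowLen ν.rowLen (b - a) a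
    (fun i h h' => hlt i h (by omega)) (fun i h' h'' => (hstep i h' (by omega)).2.1)
  have e : a + (b - a) = b := by omega
  rw [e] at h2 h3
  have hL : L'.length = r := by
    rw [← hlen, ← List.toFinset_card_of_nodup hnd,
      ← List.toFinset_card_of_nodup (RibbonStep.nodup h1)]
    congr 1
    ext c
    rw [List.mem_toFinset, List.mem_toFinset, h2, hmem]
    refine ⟨fun h => h.2.2, fun h => ?_⟩
    have := hrow c ((hmem c).2 h)
    exact ⟨this.1, this.2, h⟩
  exact ⟨a, b, hab, hout, fun i h h' => (hstep i h h').2.1, by omega⟩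

theorem IsRimMove.ribbonSign {r a b : ℕ} {μ ν : YoungDiagram} (hr : 0 < r)
    (h : IsRimMove r a b μ.rowLen ν.rowLen) : ribbonSign μ ν = (-1) ^ (b - a) := by
  have hlt := h.lt hr (rowLen_antitone μ) (rowLen_antitone ν)
  have : (ν.cells \ μ.cells).image Prod.fst = Icc a b := by
    ext i
    rw [mem_image, mem_Icc]
    constructor
    · rintro ⟨c, hc, rfl⟩
      rw [← h.mem_list_iff] at hc
      exact ⟨hc.1, hc.2.1⟩
    · rintro ⟨h1, h2⟩
      exact ⟨(i, μ.rowLen i), mem_sdiff_cells.2 ⟨le_rfl, hlt i h1 h2⟩, rfl⟩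
  rw [Polysym.ribbonSign, this, Nat.card_Icc]
  congr 1
  have := h.le
  omega

/-- The lowest row determines the ribbon. -/
theorem IsRimMove.unique {r a a' b : ℕ} {f g g' : ℕ → ℕ} (hf : Antitone f)
    (hg : Antitone g) (hg' : Antitone g') (h : IsRimMove r a b f g) (h' : IsRimMove r a' b f g') :
    g = g' := by
  have key : ∀ {a a' : ℕ} {g g' : ℕ → ℕ}, Antitone g → Antitone g' → IsRimMove r a b f g →
      IsRimMove r a' b f g' → a' ≤ a := by
    intro a a' g g' hg hg' h h'
    -- If `a < a'`, the two `top` equations give `g' a' = g a + (a' - a) > f a ≥ f (a' - 1) = g' (a'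
    -- - 1) ≥ g' a'`, which is absurd.
    by_contra! hlt
    have h1 := h.mid a le_rfl (hlt.trans_le h'.le)
    have h2 := hg (Nat.le_succ a)
    have h3 := h.top
    have h4 := h'.top
    have h5 := h'.out (a' - 1) (by omega)
    have h6 := hg' (Nat.sub_le a' 1)
    have h7 := hf (show a ≤ a' - 1 by omega)
    simp only [Nat.succ_eq_add_one] at h2
    omega
  obtain rfl : a = a' := le_antisymm (key hg' hg h' h) (key hg hg' h h')
  funext i
  by_cases hi : i < a ∨ b < i
  · rw [h.out i hi, h'.out i hi]
  · push Not at hi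
    rcases eq_or_lt_of_le hi.1 with rfl | hlt
    · have := h.top
      have := h'.top
      omega
    · have h1 := h.mid (i - 1) (by omega) (by omega)
      have h2 := h'.mid (i - 1) (by omega) (by omega)
      have e : i - 1 + 1 = i := by omega
      rw [e] at h1 h2
      omega

/-- If moving the row `b` up by `r` does not collide with another row (in terms of the shifted
row lengths), then it is given by a ribbon. -/
theorem exists_isRimMove {r b n : ℕ} {f : ℕ → ℕ} (hr : 0 < r) (hb : b < n) (hf : Antitone f)
    (hfn : ∀ i, n ≤ i → f i = 0)
    (hcol : ∀ i, i < n → f i + b ≠ f b + r + i) :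
    ∃ (a : ℕ) (ν : YoungDiagram), IsRimMove r a b f ν.rowLen ∧ ν.rowLen n = 0 := by
  classical
  -- The sequence `f i - i` is strictly decreasing, and `f b - b + r` has to be inserted into it:
  -- `a` is the first row that it reaches. Equality is excluded by `hcol`.
  have hex : ∃ a, f a + b ≤ f b + r + a := ⟨b, by omega⟩
  set a := Nat.find hex with ha
  have ha1 : f a + b ≤ f b + r + a := Nat.find_spec hex
  have ha2 : ∀ i, i < a → f b + r + i < f i + b := fun i hi => not_le.1 (Nat.find_min hex hi)
  have hab : a ≤ b := Nat.find_min' hex (by omega)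
  have ha3 : f a + b < f b + r + a := lt_of_le_of_ne ha1 (hcol a (by omega))
  let g : ℕ → ℕ := fun i => if i < a then f i else if i = a then f b + r + a - b else
    if i ≤ b then f (i - 1) + 1 else f i
  have hg : Antitone g := by
    refine antitone_nat_of_succ_le fun i => ?_
    have h1 := hf (Nat.le_succ i)
    have h2 := hf (Nat.sub_le i 1)
    have h3 := ha2 i
    simp only [Nat.succ_eq_add_one] at h1
    simp only [g]
    split_ifs <;> first | omega | skip
    all_goals try simp only [Nat.add_sub_cancel]
    all_goals try (have : i = a := by omega); try subst this
    all_goals omega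
  have hgn : ∀ i, n ≤ i → g i = 0 := by
    intro i hi
    simp only [g]
    rw [if_neg (by omega), if_neg (by omega), if_neg (by omega), hfn i hi]
  refine ⟨a, diagramOfFun n g hg, ?_, ?_⟩
  · have : (diagramOfFun n g hg).rowLen = g := funext (rowLen_diagramOfFun hg hgn)
    rw [this]
    refine ⟨hab, ?_, ?_, ?_⟩
    · intro i hi
      simp only [g]
      split_ifs <;> first | rfl | omega
    · intro i h h'
      simp only [g]
      rw [if_neg (by omega), if_neg (by omega), if_pos (by omega), Nat.add_sub_cancel]
    · simp only [g]
      rw [if_neg (lt_irrefl a)]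
      simp only [if_true]
      omega
  · rw [rowLen_diagramOfFun hg hgn]
    exact hgn n le_rfl

/-! ### Alternants -/

variable {R : Type*} [CommRing R]

/-- Subtracting from each column the multiple of its predecessor that kills its entry in row 0
leaves `y 0 ^ L 0` alone in that row. The other entries `y_i^{L (k+1)} - y_i^{L k} y_0^{L (k+1) - L
k}` are `y_i - y_0` times a geometric sum. The row factors come out, and multilinearity in the
columns leaves smaller alternants whose exponents interlace with `L`. -/
theorem det_pow_eq_sum {n : ℕ} (y : Fin (n + 1) → R) (L : ℕ → ℕ) (hL : Monotone L) :
    (Matrix.of fun i j : Fin (n + 1) => y i ^ L j).det =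
      y 0 ^ L 0 * ((∏ i : Fin n, (y i.succ - y 0)) *
        ∑ m ∈ Fintype.piFinset fun j : Fin n => Ico (L j) (L (j + 1)),
          (∏ j : Fin n, y 0 ^ (L (j + 1) - 1 - m j)) *
            (Matrix.of fun i j : Fin n => y i.succ ^ m j).det) := by
  let B : Matrix (Fin (n + 1)) (Fin (n + 1)) R := Matrix.of fun i j =>
    Fin.cases (y i ^ L 0)
      (fun k : Fin n => y i ^ L (k + 1) - y i ^ L k * y 0 ^ (L (k + 1) - L k)) j
  have h1 : (Matrix.of fun i j : Fin (n + 1) => y i ^ L j).det = B.det := by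
    refine Matrix.det_eq_of_forall_col_eq_smul_add_pred
      (fun k : Fin n => y 0 ^ (L (k + 1) - L k)) (fun i => rfl) (fun i k => ?_)
    simp only [Matrix.of_apply, Fin.val_succ, B, Fin.cases_succ, Fin.val_castSucc]
    ring
  have h2 : B.det = y 0 ^ L 0 * (B.submatrix Fin.succ Fin.succ).det := by
    rw [Matrix.det_succ_row_zero, Fin.sum_univ_succ, Finset.sum_eq_zero, add_zero]
    · simp [B]
    · intro k _
      have : B 0 k.succ = 0 := by
        simp only [Matrix.of_apply, B, Fin.cases_succ]
        rw [← pow_add, Nat.add_sub_cancel' (hL (Nat.le_succ _)), sub_self]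
      rw [this]
      ring
  have h3 : B.submatrix Fin.succ Fin.succ = Matrix.of fun i j : Fin n =>
      (y i.succ - y 0) * (Matrix.of fun i j : Fin n =>
        ∑ m ∈ Ico (L j) (L (j + 1)), y 0 ^ (L (j + 1) - 1 - m) * y i.succ ^ m) i j := by
    ext i k
    simp only [Matrix.submatrix_apply, Matrix.of_apply, B, Fin.cases_succ]
    rw [← mul_geom_sum₂_Ico _ _ (hL (Nat.le_succ _))]
    simp only [mul_comm, Nat.succ_eq_add_one]
  rw [h1, h2, h3, Matrix.det_mul_column]
  congr 2
  rw [← Matrix.det_transpose]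
  -- Multilinearity is stated for rows, hence the transposes on both sides.
  have h4 := Matrix.detRowAlternating.toMultilinearMap.map_sum_finset
    (fun (k : Fin n) (m : ℕ) (i : Fin n) => y 0 ^ (L (k + 1) - 1 - m) * y i.succ ^ m)
    (fun j : Fin n => Ico (L j) (L (j + 1)))
  refine Eq.trans ?_ (h4.trans ?_)
  · change Matrix.det _ = Matrix.det _
    congr 1
    ext k i
    simp [Finset.sum_apply]
  · refine sum_congr rfl fun m _ => ?_
    change Matrix.det _ = _
    rw [← Matrix.det_transpose (Matrix.of fun i j : Fin n => y i.succ ^ m j)]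
    exact Matrix.det_mul_column (fun j : Fin n => y 0 ^ (L (j + 1) - 1 - m j))
      (Matrix.of fun i j : Fin n => y i.succ ^ m j).transpose

/-- The alternant `det (x_i ^ l_j)`. -/
def alt (n : ℕ) (x : ℕ → R) (l : ℕ → ℕ) : R :=
  (Matrix.of fun i j : Fin n => x i ^ l j).det

/-- The exponents of the alternant of a Young diagram, in decreasing order. -/
def shifted (n : ℕ) (f : ℕ → ℕ) (i : ℕ) : ℕ := f i + (n - 1 - i)

/-- Reversing rows and columns together costs no sign. It puts the exponents of a diagram in
increasing order and the last variable first, as `det_pow_eq_sum` requires. -/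
theorem alt_rev (n : ℕ) (x : ℕ → R) (l : ℕ → ℕ) :
    alt n x l = (Matrix.of fun i j : Fin n => x (n - 1 - i) ^ l (n - 1 - j)).det := by
  rw [alt, ← Matrix.det_submatrix_equiv_self Fin.revPerm]
  congr 1
  ext i j
  simp only [Matrix.submatrix_apply, Matrix.of_apply, Fin.revPerm_apply, Fin.val_rev]
  congr 2 <;> omega

theorem finite_stripRemovals (lam : YoungDiagram) (n : ℕ) : {μ : YoungDiagram |
    (∀ i, lam.rowLen (i + 1) ≤ μ.rowLen i ∧ μ.rowLen i ≤ lam.rowLen i) ∧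
      μ.rowLen n = 0}.Finite :=
  (finite_card_le lam.card).subset fun _ h =>
    card_le_card (YoungDiagram.cells_subset_iff.2 (le_iff_rowLen.2 fun i => (h.1 i).2))

/-- The diagrams with at most `n` rows that arise from `lam` by removing a horizontal strip. -/
def stripRemovals (lam : YoungDiagram) (n : ℕ) : Finset YoungDiagram :=
  (finite_stripRemovals lam n).toFinset

theorem mem_stripRemovals {lam μ : YoungDiagram} {n : ℕ} : μ ∈ stripRemovals lam n ↔
    (∀ i, lam.rowLen (i + 1) ≤ μ.rowLen i ∧ μ.rowLen i ≤ lam.rowLen i) ∧ μ.rowLen n = 0 := by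
  rw [stripRemovals, Set.Finite.mem_toFinset, Set.mem_ofPred_eq]

/-- This is `det_pow_eq_sum` with `x n` split off: exponents that interlace with those of `lam` are
exactly the exponents of the diagrams left by removing a horizontal strip. -/
theorem alt_succ (n : ℕ) (x : ℕ → R) (lam : YoungDiagram) (hlam : lam.rowLen (n + 1) = 0) :
    alt (n + 1) x (shifted (n + 1) lam.rowLen) = (∏ i : Fin n, (x (n - 1 - i) - x n)) *
      ∑ μ ∈ stripRemovals lam n, x n ^ (lam.card - μ.card) * alt n x (shifted n μ.rowLen) := by
  let L : ℕ → ℕ := fun j => lam.rowLen (n - j) + j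
  have hL : Monotone L := by
    refine monotone_nat_of_le_succ fun j => ?_
    have := lam.rowLen_anti (n - (j + 1)) (n - j) (by omega)
    simp only [L]
    omega
  have h1 : alt (n + 1) x (shifted (n + 1) lam.rowLen) =
      (Matrix.of fun i j : Fin (n + 1) => x (n - i) ^ L j).det := by
    rw [alt_rev]
    congr 1
    ext i j
    simp only [Matrix.of_apply, shifted, L]
    have := j.2
    congr 2
    simp only [Nat.add_sub_cancel]
    omega
  rw [h1, det_pow_eq_sum (fun i : Fin (n + 1) => x (n - i)) L hL, mul_left_comm]
  have h2 : ∀ i : Fin n, x (n - (i.succ : Fin (n + 1))) = x (n - 1 - i) := by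
    intro i
    congr 1
    rw [Fin.val_succ]
    omega
  simp only [h2, Fin.val_zero, Nat.sub_zero]
  congr 1
  rw [mul_sum]
  symm
  refine sum_bij (fun μ _ (j : Fin n) => μ.rowLen (n - 1 - j) + j) ?_ ?_ ?_ ?_
  · intro μ hμ
    rw [mem_stripRemovals] at hμ
    rw [Fintype.mem_piFinset]
    intro j
    have := hμ.1 (n - 1 - j)
    have hj := j.2
    have e : n - 1 - (j : ℕ) + 1 = n - j := by omega
    have e' : n - ((j : ℕ) + 1) = n - 1 - j := by omega
    rw [e] at this
    simp only [mem_Ico, L, e']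
    omega
  · intro μ hμ ν hν h
    rw [mem_stripRemovals] at hμ hν
    refine ext_rowLen fun i => ?_
    rcases lt_or_ge i n with hi | hi
    · have := congrFun h ⟨n - 1 - i, by omega⟩
      simp only [Nat.add_right_cancel_iff] at this
      rwa [show n - 1 - (n - 1 - i) = i by omega] at this
    · rw [rowLen_eq_zero_of_le hμ.2 hi, rowLen_eq_zero_of_le hν.2 hi]
  · intro m hm
    rw [Fintype.mem_piFinset] at hm
    have hm' : ∀ i (hi : i < n), lam.rowLen (i + 1) + (n - 1 - i) ≤ m ⟨n - 1 - i, by omega⟩ ∧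
        m ⟨n - 1 - i, by omega⟩ ≤ lam.rowLen i + (n - 1 - i) := by
      intro i hi
      have := hm ⟨n - 1 - i, by omega⟩
      rw [mem_Ico] at this
      simp only [L] at this
      rw [show n - (n - 1 - i) = i + 1 by omega, show n - (n - 1 - i + 1) = i by omega] at this
      omega
    -- The row lengths of the diagram with exponents `m`; interlacing makes them weakly decreasing
    -- and the truncated subtraction exact.
    let f : ℕ → ℕ := fun i => if hi : i < n then m ⟨n - 1 - i, by omega⟩ - (n - 1 - i) else 0
    have hf : Antitone f := by
      refine antitone_nat_of_succ_le fun i => ?_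
      simp only [f]
      split_ifs with h1 h2
      · have := hm' (i + 1) h1
        have := hm' i h2
        omega
      · omega
      · exact Nat.zero_le _
      · exact le_rfl
    have hf0 : ∀ i, n ≤ i → f i = 0 := fun i hi => by simp only [f]; rw [dif_neg (by omega)]
    refine ⟨diagramOfFun n f hf, ?_, ?_⟩
    · rw [mem_stripRemovals]
      simp only [rowLen_diagramOfFun hf hf0]
      refine ⟨fun i => ?_, hf0 n le_rfl⟩
      simp only [f]
      split_ifs with hi
      · have := hm' i hi
        omega
      · rw [rowLen_eq_zero_of_le hlam (show n + 1 ≤ i + 1 by omega)]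
        simp
    · funext j
      rw [rowLen_diagramOfFun hf hf0]
      have hj := j.2
      have := hm' (n - 1 - j) (by omega)
      simp only [f]
      rw [dif_pos (by omega)]
      have e : n - 1 - (n - 1 - (j : ℕ)) = j := by omega
      simp only [e, Fin.eta] at this ⊢
      omega
  · intro μ hμ
    rw [mem_stripRemovals] at hμ
    rw [← mul_assoc]
    congr 1
    -- `L 0` is the length of row `n`, which is removed entirely; the other exponents are the cells
    -- removed from the rows above.
    · rw [prod_pow_eq_pow_sum, ← pow_add]
      congr 1
      rw [card_eq_sum_rowLen hlam, card_eq_sum_rowLen hμ.2, sum_range_succ]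
      have : ∑ j : Fin n, (L (j + 1) - 1 - (μ.rowLen (n - 1 - j) + j)) =
          ∑ i ∈ range n, (lam.rowLen i - μ.rowLen i) := by
        rw [← sum_range_reflect, ← Fin.sum_univ_eq_sum_range
          (fun j => lam.rowLen (n - 1 - j) - μ.rowLen (n - 1 - j))]
        refine sum_congr rfl fun j _ => ?_
        simp only [L]
        rw [show n - ((j : ℕ) + 1) = n - 1 - j by omega]
        omega
      rw [this]
      have h3 := sum_tsub_distrib (range n) (fun i _ => (hμ.1 i).2)
      rw [h3]
      have h4 := sum_le_sum (s := range n) (fun i _ => (hμ.1 i).2)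
      simp only [L, Nat.sub_zero]
      omega
    · rw [alt_rev]
      congr 1
      ext i j
      simp only [Matrix.of_apply, shifted]
      have := j.2
      congr 2
      omega

/-! ### Tableaux with bounded entries and the bialternant formula -/

/-- Semistandard Young tableaux with entries less than `n`. -/
abbrev BoundedTableau (lam : YoungDiagram) (n : ℕ) : Type :=
  {T : SemistandardYoungTableau lam // ∀ c ∈ lam.cells, T c.1 c.2 < n}

theorem tableau_ext {lam : YoungDiagram} {T T' : SemistandardYoungTableau lam}
    (h : ∀ c ∈ lam.cells, T c.1 c.2 = T' c.1 c.2) : T = T' := by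
  refine SemistandardYoungTableau.ext fun i j => ?_
  by_cases hc : (i, j) ∈ lam
  · exact h (i, j) hc
  · rw [T.zeros hc, T'.zeros hc]

instance BoundedTableau.instFinite (lam : YoungDiagram) (n : ℕ) :
    Finite (BoundedTableau lam n) := by
  refine Finite.of_injective
    (fun T (c : lam.cells) => (⟨T.1 c.1.1 c.1.2, T.2 c.1 c.2⟩ : Fin n)) ?_
  intro T T' h
  refine Subtype.ext (tableau_ext fun c hc => ?_)
  simpa using congrFun h ⟨c, hc⟩

instance BoundedTableau.instFintype (lam : YoungDiagram) (n : ℕ) :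
    Fintype (BoundedTableau lam n) := Fintype.ofFinite _

/-- Entries strictly increase down a column. This bounds the number of rows in terms of the entries,
and it is the source of the dominance inequality. -/
theorem le_tableau_apply {lam : YoungDiagram} (T : SemistandardYoungTableau lam) (i j : ℕ)
    (h : (i, j) ∈ lam) : i ≤ T i j := by
  induction i with
  | zero => exact Nat.zero_le _
  | succ i ih =>
    have := T.col_strict (Nat.lt_add_one i) h
    have := ih (lam.up_left_mem (Nat.le_succ i) le_rfl h)
    omega

/-- The Schur polynomial in the variables `x_0, …, x_{n-1}`. -/
def tabSum (n : ℕ) (lam : YoungDiagram) (x : ℕ → R) : R :=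
  ∑ T : BoundedTableau lam n, ∏ c ∈ lam.cells, x (T.1 c.1 c.2)

/-- The cells of a tableau with entries less than `n`. -/
def subShape {lam : YoungDiagram} (T : SemistandardYoungTableau lam) (n : ℕ) : YoungDiagram where
  cells := lam.cells.filter fun c => T c.1 c.2 < n
  isLowerSet := by
    rintro ⟨i, j⟩ ⟨i', j'⟩ ⟨hi, hj⟩ h
    rw [coe_filter, Set.mem_ofPred_eq, YoungDiagram.mem_cells] at h ⊢
    have h1 : (i', j) ∈ lam := lam.up_left_mem hi le_rfl h.1
    refine ⟨lam.up_left_mem hi hj h.1, ?_⟩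
    exact ((T.row_weak_of_le hj h1).trans (T.col_weak hi h.1)).trans_lt h.2

theorem mem_subShape {lam : YoungDiagram} {T : SemistandardYoungTableau lam} {n : ℕ} {c : ℕ × ℕ} :
    c ∈ subShape T n ↔ c ∈ lam ∧ T c.1 c.2 < n := by
  rw [← YoungDiagram.mem_cells, subShape, mem_filter, YoungDiagram.mem_cells]

/-- The largest admissible entry `n` occurs at most once in a column, so its cells form a horizontal
strip. -/
theorem subShape_mem_stripRemovals {lam : YoungDiagram} {n : ℕ} (T : BoundedTableau lam (n + 1)) :
    subShape T.1 n ∈ stripRemovals lam n := by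
  rw [mem_stripRemovals]
  refine ⟨fun i => ⟨?_, ?_⟩, ?_⟩
  · refine le_of_forall_lt fun j hj => ?_
    rw [← YoungDiagram.mem_iff_lt_rowLen] at hj ⊢
    rw [mem_subShape]
    refine ⟨lam.up_left_mem (Nat.le_succ i) le_rfl hj, ?_⟩
    have := T.1.col_strict (Nat.lt_add_one i) hj
    have := T.2 _ hj
    dsimp only at this ⊢
    omega
  · exact le_iff_rowLen.1 (fun c hc => (mem_subShape.1 hc).1) i
  · by_contra h
    have h1 : (n, 0) ∈ subShape T.1 n := YoungDiagram.mem_iff_lt_rowLen.2 (Nat.pos_of_ne_zero h)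
    rw [mem_subShape] at h1
    have := le_tableau_apply T.1 n 0 h1.1
    dsimp only at h1
    omega

/-- The restriction of a tableau to the cells with entries less than `n`. -/
def restrictTableau {lam : YoungDiagram} (T : SemistandardYoungTableau lam) (n : ℕ)
    {μ : YoungDiagram} (h : subShape T n = μ) : SemistandardYoungTableau μ where
  entry i j := if (i, j) ∈ μ then T i j else 0
  row_weak' := by
    intro i j1 j2 hj hc
    rw [if_pos hc, if_pos (μ.up_left_mem le_rfl hj.le hc)]
    exact T.row_weak hj (mem_subShape.1 (h ▸ hc)).1
  col_strict' := by
    intro i1 i2 j hi hc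
    rw [if_pos hc, if_pos (μ.up_left_mem hi.le le_rfl hc)]
    exact T.col_strict hi (mem_subShape.1 (h ▸ hc)).1
  zeros' := fun hc => if_neg hc

/-- The extension of a tableau by a horizontal strip of entries `n`. -/
def extendTableau {lam μ : YoungDiagram} {n : ℕ} (h : μ ∈ stripRemovals lam n)
    (T : BoundedTableau μ n) : SemistandardYoungTableau lam where
  entry i j := if (i, j) ∈ μ then T.1 i j else if (i, j) ∈ lam then n else 0
  row_weak' := by
    intro i j1 j2 hj hc
    have hc1 := lam.up_left_mem le_rfl hj.le hc
    by_cases h2 : (i, j2) ∈ μ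
    · rw [if_pos h2, if_pos (μ.up_left_mem le_rfl hj.le h2)]
      exact T.1.row_weak hj h2
    · rw [if_neg h2, if_pos hc, if_pos hc1]
      split_ifs with h1
      · exact (T.2 _ h1).le
      · exact le_rfl
  col_strict' := by
    intro i1 i2 j hi hc
    by_cases h2 : (i2, j) ∈ μ
    · rw [if_pos h2, if_pos (μ.up_left_mem hi.le le_rfl h2)]
      exact T.1.col_strict hi h2
    · have h1 : (i1, j) ∈ μ := by
        rw [mem_stripRemovals] at h
        rw [YoungDiagram.mem_iff_lt_rowLen] at hc ⊢
        exact (hc.trans_le (lam.rowLen_anti _ _ hi)).trans_le (h.1 i1).1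
      rw [if_pos h1, if_neg h2, if_pos hc]
      exact T.2 _ h1
  zeros' := by
    intro i j hc
    rw [mem_stripRemovals] at h
    rw [if_neg, if_neg hc]
    intro hμ
    exact hc (le_iff_rowLen.2 (fun i => (h.1 i).2) hμ)

theorem extendTableau_apply {lam μ : YoungDiagram} {n : ℕ} (h : μ ∈ stripRemovals lam n)
    (T : BoundedTableau μ n) (i j : ℕ) : extendTableau h T i j =
      if (i, j) ∈ μ then T.1 i j else if (i, j) ∈ lam then n else 0 := rfl

theorem restrictTableau_apply {lam : YoungDiagram} (T : SemistandardYoungTableau lam) (n : ℕ)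
    {μ : YoungDiagram} (h : subShape T n = μ) (i j : ℕ) : restrictTableau T n h i j =
      if (i, j) ∈ μ then T i j else 0 := rfl

theorem subShape_extendTableau {lam μ : YoungDiagram} {n : ℕ} (h : μ ∈ stripRemovals lam n)
    (T : BoundedTableau μ n) : subShape (extendTableau h T) n = μ := by
  refine SetLike.ext fun c => ?_
  have hle : μ ≤ lam := le_iff_rowLen.2 fun i => ((mem_stripRemovals.1 h).1 i).2
  rw [mem_subShape, extendTableau_apply]
  constructor
  · rintro ⟨h1, h2⟩
    by_contra hc
    rw [if_neg hc, if_pos h1] at h2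
    exact lt_irrefl _ h2
  · intro hc
    rw [if_pos hc]
    exact ⟨hle hc, T.2 c hc⟩

/-- Group the tableaux by the shape of their entries below `n`; every remaining cell contains `n`
and contributes `x n`. This is the recursion of `alt_succ` without the product of differences. -/
theorem tabSum_succ (n : ℕ) (lam : YoungDiagram) (x : ℕ → R) :
    tabSum (n + 1) lam x =
      ∑ μ ∈ stripRemovals lam n, x n ^ (lam.card - μ.card) * tabSum n μ x := by
  classical
  rw [tabSum, ← sum_fiberwise_of_maps_to (g := fun T => subShape T.1 n)
    (fun T _ => subShape_mem_stripRemovals T)]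
  refine sum_congr rfl fun μ hμ => ?_
  have hle : μ ≤ lam := le_iff_rowLen.2 fun i => ((mem_stripRemovals.1 hμ).1 i).2
  have hsub : μ.cells ⊆ lam.cells := YoungDiagram.cells_subset_iff.2 hle
  rw [tabSum, mul_sum]
  symm
  refine sum_bij (fun T _ => ⟨extendTableau hμ T, ?_⟩) ?_ ?_ ?_ ?_
  · intro c hc
    rw [extendTableau_apply, if_pos (show (c.1, c.2) ∈ lam from hc)]
    split_ifs with h
    · exact (T.2 c h).trans (Nat.lt_succ_self n)
    · exact Nat.lt_succ_self n
  · intro T _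
    rw [mem_filter]
    exact ⟨mem_univ _, subShape_extendTableau hμ T⟩
  · intro T _ T' _ h
    refine Subtype.ext (tableau_ext fun c hc => ?_)
    have := congrArg (fun S => S.1 c.1 c.2) h
    simp only [extendTableau_apply] at this
    rwa [if_pos (show (c.1, c.2) ∈ μ from hc), if_pos (show (c.1, c.2) ∈ μ from hc)] at this
  · intro T hT
    rw [mem_filter] at hT
    refine ⟨⟨restrictTableau T.1 n hT.2, ?_⟩, mem_univ _, ?_⟩
    · intro c hc
      rw [restrictTableau_apply, if_pos (show (c.1, c.2) ∈ μ from hc)]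
      have h1 : c ∈ subShape T.1 n := by rw [hT.2]; exact hc
      exact (mem_subShape.1 h1).2
    · refine Subtype.ext (tableau_ext fun c hc => ?_)
      rw [extendTableau_apply, if_pos (show (c.1, c.2) ∈ lam from hc)]
      dsimp only
      rw [restrictTableau_apply]
      split_ifs with h
      · rfl
      · have h1 := T.2 c hc
        have h2 : ¬ T.1 c.1 c.2 < n := fun h3 => h (by
          rw [← hT.2]
          exact mem_subShape.2 ⟨hc, h3⟩)
        omega
  · intro T _
    rw [← prod_sdiff hsub]
    congr 1
    · rw [prod_congr rfl (g := fun _ => x n), prod_const, card_sdiff_of_subset hsub]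
      intro c hc
      rw [mem_sdiff] at hc
      dsimp only
      rw [extendTableau_apply, if_neg (show (c.1, c.2) ∉ μ from hc.2),
        if_pos (show (c.1, c.2) ∈ lam from hc.1)]
    · refine prod_congr rfl fun c hc => ?_
      dsimp only
      rw [extendTableau_apply, if_pos (show (c.1, c.2) ∈ μ from hc)]

theorem stripRemovals_bot (n : ℕ) : stripRemovals ⊥ n = {⊥} := by
  have h0 : ∀ i, (⊥ : YoungDiagram).rowLen i = 0 := fun i =>
    rowLen_eq_zero_of_card_le (Nat.zero_le i)
  ext μ
  rw [mem_stripRemovals, mem_singleton]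
  constructor
  · intro h
    refine ext_rowLen fun i => ?_
    rw [h0]
    exact Nat.le_zero.1 ((h.1 i).2.trans (h0 i).le)
  · rintro rfl
    simp [h0]

/-- The bialternant formula for Schur polynomials. -/
theorem tabSum_mul_alt (n : ℕ) (lam : YoungDiagram) (hlam : lam.rowLen n = 0) (x : ℕ → R) :
    tabSum n lam x * alt n x (shifted n (⊥ : YoungDiagram).rowLen) =
      alt n x (shifted n lam.rowLen) := by
  have h0 : ∀ i, (⊥ : YoungDiagram).rowLen i = 0 := fun i =>
    rowLen_eq_zero_of_card_le (Nat.zero_le i)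
  induction n generalizing lam with
  | zero =>
    obtain rfl : lam = ⊥ := ext_rowLen fun i => by
      rw [h0, rowLen_eq_zero_of_le hlam (Nat.zero_le i)]
    have hT : ∀ T T' : BoundedTableau ⊥ 0, T = T' := fun T T' =>
      Subtype.ext (tableau_ext fun c hc => by simp at hc)
    have : Unique (BoundedTableau ⊥ 0) :=
      ⟨⟨⟨default, fun c hc => by simp at hc⟩⟩, fun T => hT _ _⟩
    rw [tabSum, Fintype.sum_unique]
    simp [alt]
  | succ n ih =>
    -- The alternants of `lam` and of the empty diagram split off the same product of differences,
    -- and the latter has a single summand.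
    rw [alt_succ n x lam hlam, alt_succ n x ⊥ (h0 _), stripRemovals_bot, sum_singleton,
      Nat.sub_self, pow_zero, one_mul, tabSum_succ, mul_left_comm, sum_mul]
    congr 1
    refine sum_congr rfl fun μ hμ => ?_
    rw [mul_assoc, ih μ (mem_stripRemovals.1 hμ).2]

/-! ### The Murnaghan–Nakayama rule in finitely many variables -/

/-- Raising one of the exponents of an alternant by `r`. -/
theorem sum_pow_mul_alt (n r : ℕ) (x : ℕ → R) (l : ℕ → ℕ) :
    (∑ i ∈ range n, x i ^ r) * alt n x l =
      ∑ j ∈ range n, alt n x (Function.update l j (l j + r)) := by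
  -- In the Leibniz expansion, raising exponent `j` multiplies the term of `s` by `x (s j) ^ r`;
  -- summing over `j` gives the power sum for every `s`.
  have h : ∀ j : Fin n, alt n x (Function.update l j (l j + r)) =
      ∑ s : Equiv.Perm (Fin n), (Equiv.Perm.sign s : ℤ) • (x (s j) ^ r * ∏ i : Fin n, x (s i) ^ l i) := by
    intro j
    rw [alt, Matrix.det_apply]
    refine sum_congr rfl fun s _ => ?_
    rw [Units.smul_def]
    congr 1
    simp only [Matrix.of_apply]
    rw [← mul_prod_erase univ _ (mem_univ j), ← mul_prod_erase univ (fun i : Fin n => x (s i) ^ l i)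
      (mem_univ j), Function.update_self, pow_add, mul_comm (x (s j) ^ l j), mul_assoc]
    congr 2
    refine prod_congr rfl fun i hi => ?_
    rw [Function.update_of_ne]
    exact fun h => (mem_erase.1 hi).1 (Fin.ext h)
  rw [← Fin.sum_univ_eq_sum_range (fun j => alt n x (Function.update l j (l j + r))),
    sum_congr rfl (fun j _ => h j), sum_comm, alt, Matrix.det_apply, mul_sum]
  refine sum_congr rfl fun s _ => ?_
  rw [← smul_sum, ← sum_mul, Units.smul_def, mul_smul_comm]
  congr 2
  rw [← Fin.sum_univ_eq_sum_range (fun i => x i ^ r)]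
  exact (Equiv.sum_comp s (fun i => x i ^ r)).symm

theorem alt_eq_zero (n : ℕ) (x : ℕ → R) (l : ℕ → ℕ) {i j : ℕ} (hi : i < n) (hj : j < n)
    (hij : i ≠ j) (h : l i = l j) : alt n x l = 0 :=
  Matrix.det_zero_of_column_eq (i := ⟨i, hi⟩) (j := ⟨j, hj⟩) (by simpa using hij)
    (fun k => by simp [h])

/-- The row `b` is the last one where `f` and `g` differ. -/
theorem IsRimMove.bottom_unique {r a a' b b' : ℕ} {f g : ℕ → ℕ} (hr : 0 < r) (hf : Antitone f)
    (hg : Antitone g) (h : IsRimMove r a b f g) (h' : IsRimMove r a' b' f g) : b = b' := by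
  have key : ∀ {a a' b b' : ℕ}, IsRimMove r a b f g → IsRimMove r a' b' f g → b' ≤ b := by
    intro a a' b b' h h'
    by_contra! hlt
    exact (h'.lt hr hf hg b' h'.le le_rfl).ne (h.out b' (Or.inr hlt)).symm
  exact le_antisymm (key h' h) (key h h')

/-- The raised exponents of `f` are those of `g` permuted by the cycle `a ↦ a + 1 ↦ ⋯ ↦ b ↦ a`,
whose sign is `(-1)^(b-a)`. -/
theorem IsRimMove.alt_update {r a b n : ℕ} {f g : ℕ → ℕ} (h : IsRimMove r a b f g) (hb : b < n)
    (x : ℕ → R) :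
    alt n x (Function.update (shifted n f) b (shifted n f b + r)) =
      (-1) ^ (b - a) * alt n x (shifted n g) := by
  have hab := h.le
  have : NeZero n := ⟨by omega⟩
  let c := Fin.cycleIcc (⟨a, by omega⟩ : Fin n) ⟨b, hb⟩
  have hs : (Equiv.Perm.sign c : ℤ) = (-1) ^ (b - a) := by
    have := Fin.sign_cycleIcc_of_le (i := (⟨a, by omega⟩ : Fin n)) (j := ⟨b, hb⟩) hab
    rw [show Equiv.Perm.sign c = _ from this]
    simp
  have key := Matrix.det_permute' c (Matrix.of fun i j : Fin n => x i ^ shifted n g j)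
  rw [hs] at key
  push_cast at key
  rw [alt, alt, ← key]
  congr 1
  ext i j
  simp only [Matrix.submatrix_apply, Matrix.of_apply, id_eq]
  congr 1
  have h1 := j.2
  rcases lt_or_ge (j : ℕ) a with hj | hj
  · rw [show c j = j from Fin.cycleIcc_of_lt (by simpa [Fin.lt_def] using hj),
      Function.update_of_ne (by omega), shifted, shifted, h.out j (Or.inl hj)]
  · rcases lt_trichotomy (j : ℕ) b with hj' | hj' | hj'
    · rw [show c j = j + 1 from Fin.cycleIcc_of_ge_of_lt (by simpa [Fin.le_def] using hj)
        (by simpa [Fin.lt_def] using hj'), Function.update_of_ne (by omega), shifted, shifted,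
        Fin.val_add_one_of_lt' (by omega), h.mid j hj hj']
      omega
    · obtain rfl : j = ⟨b, hb⟩ := Fin.ext hj'
      rw [show c ⟨b, hb⟩ = ⟨a, by omega⟩ from Fin.cycleIcc_of_last (by simpa [Fin.le_def] using hj)]
      simp only [Function.update_self, shifted]
      have := h.top
      omega
    · rw [show c j = j from Fin.cycleIcc_of_gt (by simpa [Fin.lt_def] using hj'),
      Function.update_of_ne (by omega), shifted, shifted, h.out j (Or.inr hj')]

theorem finite_isRibbon (μ : YoungDiagram) (r : ℕ) : {ν | IsRibbon r μ ν}.Finite :=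
  (finite_card_le (μ.card + r)).subset fun _ h => (IsRibbon.card_add h).le

/-- The diagrams that arise from `μ` by adding an `r`-ribbon. -/
def ribbonAdditions (μ : YoungDiagram) (r : ℕ) : Finset YoungDiagram :=
  (finite_isRibbon μ r).toFinset

theorem mem_ribbonAdditions {μ ν : YoungDiagram} {r : ℕ} :
    ν ∈ ribbonAdditions μ r ↔ IsRibbon r μ ν := by
  rw [ribbonAdditions, Set.Finite.mem_toFinset, Set.mem_ofPred_eq]

/-- Ribbons are indexed by their lowest row `b`, the row whose exponent is raised. A row that is not
the lowest row of any ribbon yields two equal exponents, hence zero. The bound on `n` ensures that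
every `ν` fits into `n` rows. -/
theorem sum_pow_mul_alt_shifted {n r : ℕ} (hr : 0 < r) (μ : YoungDiagram) (hn : μ.card + r ≤ n)
    (x : ℕ → R) :
    (∑ i ∈ range n, x i ^ r) * alt n x (shifted n μ.rowLen) =
      ∑ ν ∈ ribbonAdditions μ r, (ribbonSign μ ν : R) * alt n x (shifted n ν.rowLen) := by
  classical
  rw [sum_pow_mul_alt]
  have hex : ∀ ν ∈ ribbonAdditions μ r, ∃ b, ∃ a, IsRimMove r a b μ.rowLen ν.rowLen := by
    intro ν hν
    obtain ⟨a, b, h⟩ := IsRibbon.exists_isRimMove hr (mem_ribbonAdditions.1 hν)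
    exact ⟨b, a, h⟩
  choose! b hb using hex
  have hbn : ∀ ν ∈ ribbonAdditions μ r, b ν < n := by
    intro ν hν
    obtain ⟨a, h⟩ := hb ν hν
    have h1 := h.lt hr (rowLen_antitone μ) (rowLen_antitone ν) (b ν) h.le le_rfl
    by_contra! h2
    have h3 := IsRibbon.card_add (mem_ribbonAdditions.1 hν)
    rw [rowLen_eq_zero_of_card_le (μ := ν) (by omega)] at h1
    omega
  symm
  refine sum_of_injOn b ?_ ?_ ?_ ?_
  · intro ν hν ν' hν' h
    obtain ⟨a, h1⟩ := hb ν hν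
    obtain ⟨a', h1'⟩ := hb ν' hν'
    rw [← h] at h1'
    have := h1.unique (rowLen_antitone μ) (rowLen_antitone ν) (rowLen_antitone ν') h1'
    exact ext_rowLen fun i => congrFun this i
  · intro ν hν
    exact mem_coe.2 (mem_range.2 (hbn ν hν))
  · intro j hj hj'
    rw [mem_range] at hj
    by_contra hne
    have hcol : ∀ i, i < n → μ.rowLen i + j ≠ μ.rowLen j + r + i := by
      intro i hi heq
      refine hne (alt_eq_zero n x _ hi hj (fun hij => ?_) ?_)
      · subst hij
        omega
      · rw [Function.update_self, Function.update_of_ne, shifted, shifted]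
        · omega
        · rintro rfl
          omega
    obtain ⟨a, ν, h, -⟩ := exists_isRimMove hr hj (rowLen_antitone μ)
      (fun i hi => rowLen_eq_zero_of_card_le (by omega)) hcol
    refine hj' ⟨ν, mem_coe.2 (mem_ribbonAdditions.2 (h.isRibbon hr)), ?_⟩
    obtain ⟨a', h'⟩ := hb ν (mem_ribbonAdditions.2 (h.isRibbon hr))
    exact h'.bottom_unique hr (rowLen_antitone μ) (rowLen_antitone ν) h
  · intro ν hν
    obtain ⟨a, h⟩ := hb ν hν
    rw [h.alt_update (hbn ν hν), h.ribbonSign hr]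
    push_cast
    rfl

theorem alt_ne_zero [IsDomain R] (n : ℕ) (x : ℕ → R) (hx : Set.InjOn x (Set.Iio n)) :
    alt n x (shifted n (⊥ : YoungDiagram).rowLen) ≠ 0 := by
  have h0 : ∀ i, (⊥ : YoungDiagram).rowLen i = 0 := fun i =>
    rowLen_eq_zero_of_card_le (Nat.zero_le i)
  have : alt n x (shifted n (⊥ : YoungDiagram).rowLen) =
      (Matrix.vandermonde fun i : Fin n => x (n - 1 - i)).det := by
    rw [alt_rev]
    congr 1
    ext i j
    simp only [Matrix.of_apply, Matrix.vandermonde_apply, shifted, h0]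
    congr 1
    omega
  rw [this, Matrix.det_vandermonde_ne_zero_iff]
  intro i j h
  have h1 := i.2
  have h2 := j.2
  have := hx (show n - 1 - (i : ℕ) ∈ Set.Iio n by rw [Set.mem_Iio]; omega)
    (show n - 1 - (j : ℕ) ∈ Set.Iio n by rw [Set.mem_Iio]; omega) h
  exact Fin.ext (by omega)

theorem sum_pow_mul_tabSum [IsDomain R] {n r : ℕ} (hr : 0 < r) (μ : YoungDiagram)
    (hn : μ.card + r ≤ n) (x : ℕ → R) (hx : Set.InjOn x (Set.Iio n)) :
    tabSum n μ x * (∑ i ∈ range n, x i ^ r) =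
      ∑ ν ∈ ribbonAdditions μ r, (ribbonSign μ ν : R) * tabSum n ν x := by
  refine mul_right_cancel₀ (alt_ne_zero n x hx) ?_
  rw [mul_right_comm, tabSum_mul_alt n μ (rowLen_eq_zero_of_card_le (by omega)), mul_comm,
    sum_pow_mul_alt_shifted hr μ hn, sum_mul]
  refine sum_congr rfl fun ν hν => ?_
  have := IsRibbon.card_add (mem_ribbonAdditions.1 hν)
  rw [mul_assoc, tabSum_mul_alt n ν (rowLen_eq_zero_of_card_le (by omega))]

/-! ### Schur functions as generating functions of tableaux -/

/-- The content of a tableau: the number of entries equal to `i`, for each `i`. -/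
def content {lam : YoungDiagram} (T : SemistandardYoungTableau lam) : ℕ →₀ ℕ :=
  ∑ c ∈ lam.cells, Finsupp.single (T c.1 c.2) 1

theorem content_apply {lam : YoungDiagram} (T : SemistandardYoungTableau lam) (i : ℕ) :
    content T i = #{c ∈ lam.cells | T c.1 c.2 = i} := by
  rw [content, Finsupp.finsetSum_apply, card_filter]
  exact sum_congr rfl fun c _ => Finsupp.single_apply

theorem degree_content {lam : YoungDiagram} (T : SemistandardYoungTableau lam) :
    (content T).degree = lam.card := by
  rw [content, map_sum]
  simp

/-- The number of tableaux with a given content, which need not be a partition. -/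
def tabCount (lam : YoungDiagram) (e : ℕ →₀ ℕ) : ℕ :=
  Nat.card {T : SemistandardYoungTableau lam // content T = e}

theorem prod_X_tableau {lam : YoungDiagram} (T : SemistandardYoungTableau lam)
    (s : Equiv.Perm ℕ) :
    ∏ c ∈ lam.cells, (MvPowerSeries.X (s (T c.1 c.2)) : MvPowerSeries ℕ ℚ) =
      MvPowerSeries.monomial ((content T).mapDomain s) 1 := by
  simp only [MvPowerSeries.X_def]
  rw [MvPowerSeries.prod_monomial, prod_const_one, content, Finsupp.mapDomain_finsetSum]
  simp only [Finsupp.mapDomain_single]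

theorem coeff_tabSum_mapDomain (n : ℕ) (lam : YoungDiagram) (s : Equiv.Perm ℕ) (e : ℕ →₀ ℕ) :
    MvPowerSeries.coeff (e.mapDomain s) (tabSum n lam fun i =>
      (MvPowerSeries.X (s i) : MvPowerSeries ℕ ℚ)) =
    #{T : BoundedTableau lam n | content T.1 = e} := by
  rw [tabSum, map_sum, card_filter, Nat.cast_sum]
  refine sum_congr rfl fun T _ => ?_
  rw [prod_X_tableau, MvPowerSeries.coeff_monomial]
  simp only [(Finsupp.mapDomain_injective s.injective).eq_iff]
  simp [eq_comm]

theorem coeff_tabSum_eq_card (n : ℕ) (lam : YoungDiagram) (e : ℕ →₀ ℕ) :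
    MvPowerSeries.coeff e (tabSum n lam (MvPowerSeries.X : ℕ → MvPowerSeries ℕ ℚ)) =
      #{T : BoundedTableau lam n | content T.1 = e} := by
  have := coeff_tabSum_mapDomain n lam 1 e
  rwa [Equiv.Perm.coe_one, Finsupp.mapDomain_id] at this

/-- A tableau with content `e` has only entries from the support of `e`, so the bound on the entries
is automatic. -/
theorem coeff_tabSum (n : ℕ) (lam : YoungDiagram) (e : ℕ →₀ ℕ) (he : ∀ i, n ≤ i → e i = 0) :
    MvPowerSeries.coeff e (tabSum n lam (MvPowerSeries.X : ℕ → MvPowerSeries ℕ ℚ)) =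
      tabCount lam e := by
  rw [coeff_tabSum_eq_card, tabCount, ← Fintype.card_subtype, ← Nat.card_eq_fintype_card]
  congr 1
  refine Nat.card_congr ⟨fun T => ⟨T.1.1, T.2⟩, fun T => ⟨⟨T.1, fun c hc => ?_⟩, T.2⟩,
    fun T => rfl, fun T => rfl⟩
  by_contra! h
  have h1 := (DFunLike.congr_fun T.2 _).trans (he _ h)
  rw [content_apply, card_eq_zero] at h1
  have : c ∈ ({c' ∈ lam.cells | T.1 c'.1 c'.2 = T.1 c.1 c.2} : Finset (ℕ × ℕ)) :=
    mem_filter.2 ⟨hc, rfl⟩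
  rw [h1] at this
  simp at this

/-! ### Symmetry of Schur polynomials and of tableau counts -/

instance instIsDomainMvPowerSeries : IsDomain (MvPowerSeries ℕ ℚ) :=
  NoZeroDivisors.to_isDomain _

/-- Schur polynomials are symmetric. -/
theorem tabSum_perm (n : ℕ) (lam : YoungDiagram) (hlam : lam.rowLen n = 0)
    (s : Equiv.Perm (Fin n)) (t : Equiv.Perm ℕ) (hst : ∀ i : Fin n, t i = s i) :
    tabSum n lam (fun i => (MvPowerSeries.X (t i) : MvPowerSeries ℕ ℚ)) =
      tabSum n lam MvPowerSeries.X := by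
  -- Permuting the variables permutes the rows, so both alternants in the bialternant formula change
  -- by the same sign.
  have halt : ∀ l : ℕ → ℕ, alt n (fun i => (MvPowerSeries.X (t i) : MvPowerSeries ℕ ℚ)) l =
      ((Equiv.Perm.sign s : ℤ) : MvPowerSeries ℕ ℚ) * alt n MvPowerSeries.X l := by
    intro l
    rw [alt, alt, ← Matrix.det_permute]
    congr 1
    ext1 i j
    simp [hst]
  have h1 := tabSum_mul_alt n lam hlam (fun i => (MvPowerSeries.X (t i) : MvPowerSeries ℕ ℚ))
  have h2 := tabSum_mul_alt n lam hlam (MvPowerSeries.X : ℕ → MvPowerSeries ℕ ℚ)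
  have hne : alt n (fun i => (MvPowerSeries.X (t i) : MvPowerSeries ℕ ℚ))
      (shifted n (⊥ : YoungDiagram).rowLen) ≠ 0 :=
    alt_ne_zero n _ fun i _ j _ h => t.injective (MvPowerSeries.X_inj.1 h)
  refine mul_right_cancel₀ hne ?_
  rw [h1, halt, halt, ← h2]
  ring

theorem tabCount_mapDomain (n : ℕ) (lam : YoungDiagram) (hlam : lam.rowLen n = 0)
    (s : Equiv.Perm (Fin n)) (t : Equiv.Perm ℕ) (hst : ∀ i : Fin n, t i = s i) (e : ℕ →₀ ℕ)
    (he : ∀ i, n ≤ i → e i = 0) (he' : ∀ i, n ≤ i → e.mapDomain t i = 0) :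
    tabCount lam (e.mapDomain t) = tabCount lam e := by
  have h := coeff_tabSum_mapDomain n lam t e
  rw [tabSum_perm n lam hlam s t hst, coeff_tabSum n lam _ he', ← coeff_tabSum_eq_card,
    coeff_tabSum n lam _ he] at h
  exact_mod_cast h

/-- Equal multisets of values mean equinumerous fibres; bijections between the fibres assemble to a
permutation. -/
theorem exists_perm_of_map_eq {α β : Type*} [Fintype α] {f g : α → β}
    (h : (univ : Finset α).val.map f = (univ : Finset α).val.map g) :
    ∃ s : Equiv.Perm α, ∀ a, g (s a) = f a := by
  classical
  have hc : ∀ y, Nonempty ({a // f a = y} ≃ {a // g a = y}) := by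
    intro y
    rw [← Fintype.card_eq, Fintype.card_subtype, Fintype.card_subtype]
    have := congrArg (Multiset.count y) h
    rw [Multiset.count_map, Multiset.count_map] at this
    simpa [Finset.card, eq_comm] using this
  let c := fun y => (hc y).some
  let s : Equiv.Perm α := (Equiv.sigmaFiberEquiv f).symm.trans
    ((Equiv.sigmaCongrRight c).trans (Equiv.sigmaFiberEquiv g))
  exact ⟨s, fun a => (c (f a) ⟨a, rfl⟩).2⟩

theorem map_val_range (n : ℕ) (e : ℕ →₀ ℕ) (he : ∀ i, n ≤ i → e i = 0) :
    (univ : Finset (Fin n)).val.map (fun i : Fin n => e i) =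
      e.support.val.map e + Multiset.replicate (n - #e.support) 0 := by
  classical
  have h1 : (univ : Finset (Fin n)).val.map (fun i : Fin n => e i) = (range n).val.map e := by
    have : range n = (univ : Finset (Fin n)).map Fin.valEmbedding := by
      rw [Fin.map_valEmbedding_univ, Nat.Iio_eq_range]
    rw [this, map_val, Multiset.map_map]
    rfl
  have hsub : e.support ⊆ range n := by
    intro i hi
    rw [mem_range]
    by_contra! h
    exact Finsupp.mem_support_iff.1 hi (he i h)
  rw [h1, ← union_sdiff_of_subset hsub, ← disjUnion_eq_union _ _ disjoint_sdiff,
    disjUnion_val, Multiset.map_add]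
  congr 1
  rw [Multiset.map_congr rfl (g := fun _ => 0), Multiset.map_const']
  · congr 1
    change #((range n) \ e.support) = _
    rw [card_sdiff_of_subset hsub, card_range]
  · intro i hi
    rw [mem_val, mem_sdiff, Finsupp.notMem_support_iff] at hi
    exact hi.2

/-- Two exponent vectors with the same nonzero values differ by a permutation of finitely many
indices, under which Schur polynomials are invariant. -/
theorem tabCount_eq_of_map_eq (lam : YoungDiagram) {e e' : ℕ →₀ ℕ}
    (h : e.support.val.map e = e'.support.val.map e') : tabCount lam e = tabCount lam e' := by
  classical
  have hb : ∀ f : ℕ →₀ ℕ, ∀ i, f.support.sup id + 1 ≤ i → f i = 0 := by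
    intro f i hi
    by_contra hf
    have := le_sup (f := id) (Finsupp.mem_support_iff.2 hf)
    simp only [id_eq] at this
    omega
  -- Large enough for both supports and for the rows of `lam`.
  set n := lam.card + (e.support.sup id + 1) + (e'.support.sup id + 1) with hn
  have he : ∀ i, n ≤ i → e i = 0 := fun i hi => hb e i (by omega)
  have he' : ∀ i, n ≤ i → e' i = 0 := fun i hi => hb e' i (by omega)
  have hcard : #e.support = #e'.support := by
    have := congrArg Multiset.card h
    simpa using this
  obtain ⟨s, hs⟩ := exists_perm_of_map_eq (f := fun i : Fin n => e i) (g := fun i : Fin n => e' i)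
    (by rw [map_val_range n e he, map_val_range n e' he', h, hcard])
  let t : Equiv.Perm ℕ := s.extendDomain Fin.equivSubtype
  have ht : ∀ i : Fin n, t i = s i := fun i =>
    Equiv.Perm.extendDomain_apply_image s Fin.equivSubtype i
  have ht' : ∀ i, n ≤ i → t i = i := fun i hi =>
    Equiv.Perm.extendDomain_apply_not_subtype s Fin.equivSubtype (by omega)
  have hmap : e.mapDomain t = e' := by
    ext i
    obtain ⟨j, rfl⟩ := t.surjective i
    rw [Finsupp.mapDomain_apply t.injective]
    rcases lt_or_ge j n with hj | hj
    · rw [show t j = s ⟨j, hj⟩ from ht ⟨j, hj⟩]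
      exact (hs ⟨j, hj⟩).symm
    · rw [ht' j hj, he j hj, he' j hj]
  rw [← hmap] at he' ⊢
  exact (tabCount_mapDomain n lam (rowLen_eq_zero_of_card_le (by omega)) s t ht e he he').symm

theorem map_toFinsupp (l : List ℕ) (hl : ∀ a ∈ l, 0 < a) :
    l.toFinsupp.support.val.map l.toFinsupp = (l : Multiset ℕ) := by
  have hsupp : l.toFinsupp.support = range l.length := by
    rw [List.toFinsupp_support, filter_eq_self]
    intro i hi
    rw [mem_range] at hi
    rw [List.getD_eq_getElem _ _ hi]
    exact (hl _ (List.getElem_mem hi)).ne'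
  rw [hsupp, range_val, Multiset.range, Multiset.map_coe]
  congr 1
  refine List.ext_getElem (by simp) fun i h1 h2 => ?_
  simp [h2]

theorem kostka_eq_tabCount (lam : YoungDiagram) {n : ℕ} (μ : n.Partition) :
    kostka lam μ = tabCount lam (μ.parts.sort (· ≥ ·)).toFinsupp := by
  refine Nat.card_congr (Equiv.subtypeEquivRight fun T => ?_)
  rw [Finsupp.ext_iff]
  refine forall_congr' fun i => ?_
  rw [content_apply, List.toFinsupp_apply]

theorem coeff_monomialSymm {n : ℕ} (μ : n.Partition) (e : ℕ →₀ ℕ) :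
    MvPowerSeries.coeff e (monomialSymm μ) =
      open Classical in if e.support.val.map e = μ.parts then 1 else 0 := rfl

theorem tabCount_eq_zero (lam : YoungDiagram) {e : ℕ →₀ ℕ} (h : e.degree ≠ lam.card) :
    tabCount lam e = 0 := by
  have : IsEmpty {T : SemistandardYoungTableau lam // content T = e} :=
    ⟨fun T => h (T.2 ▸ degree_content T.1)⟩
  exact Nat.card_of_isEmpty

/-- Only the partition formed by the nonzero exponents of `e` contributes. Its Kostka number counts
tableaux whose content is the sorted vector, and `tabCount_eq_of_map_eq` passes to `e` itself. -/
theorem coeff_schur (lam : YoungDiagram) (e : ℕ →₀ ℕ) :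
    MvPowerSeries.coeff e (schur lam) = tabCount lam e := by
  classical
  rw [schur, map_sum]
  simp only [map_smul, coeff_monomialSymm, smul_eq_mul, mul_ite, mul_one, mul_zero]
  have hsum : (e.support.val.map e).sum = e.degree := rfl
  by_cases h : e.degree = lam.card
  · let μ₀ : lam.card.Partition := ⟨e.support.val.map e, by
      intro i hi
      obtain ⟨j, hj, rfl⟩ := Multiset.mem_map.1 hi
      exact Nat.pos_of_ne_zero (Finsupp.mem_support_iff.1 hj), hsum.trans h⟩
    rw [sum_eq_single μ₀, if_pos rfl, kostka_eq_tabCount]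
    · congr 1
      refine tabCount_eq_of_map_eq lam ?_
      rw [map_toFinsupp, Multiset.sort_eq]
      intro a ha
      exact μ₀.parts_pos ((Multiset.mem_sort _).1 ha)
    · intro μ _ hμ
      rw [if_neg]
      intro h'
      exact hμ (Nat.Partition.ext h'.symm)
    · exact fun h' => absurd (mem_univ _) h'
  · rw [tabCount_eq_zero lam h, Nat.cast_zero]
    refine sum_eq_zero fun μ _ => if_neg fun h' => h ?_
    rw [← hsum, h', μ.parts_sum]

/-! ### The Murnaghan–Nakayama rule -/

theorem coeff_powerSum (r : ℕ) (e : ℕ →₀ ℕ) : MvPowerSeries.coeff e (powerSum r) =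
    open Classical in if ∃ j : ℕ, e = Finsupp.single j r then 1 else 0 := rfl

/-- `killCompl` sets the variables from `x_n` on to zero, which reduces identities of Schur
functions to finitely many variables. -/
theorem killCompl_schur {n : ℕ} (lam : YoungDiagram) :
    MvPowerSeries.killCompl Fin.valEmbedding (schur lam) =
      MvPowerSeries.killCompl (R := ℚ) (Fin.valEmbedding (n := n))
        (tabSum n lam MvPowerSeries.X) := by
  ext e
  rw [MvPowerSeries.coeff_killCompl, MvPowerSeries.coeff_killCompl, coeff_schur, coeff_tabSum]
  intro i hi
  refine Finsupp.embDomain_of_notMem_range _ _ _ ?_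
  rintro ⟨j, rfl⟩
  simp only [Fin.valEmbedding_apply] at hi
  omega

theorem killCompl_powerSum {n r : ℕ} (hr : 0 < r) :
    MvPowerSeries.killCompl Fin.valEmbedding (powerSum r) =
      MvPowerSeries.killCompl (R := ℚ) (Fin.valEmbedding (n := n))
        (∑ i ∈ range n, MvPowerSeries.X i ^ r) := by
  classical
  ext e
  rw [MvPowerSeries.coeff_killCompl, MvPowerSeries.coeff_killCompl, coeff_powerSum, map_sum]
  simp only [MvPowerSeries.coeff_X_pow]
  split_ifs with h
  · obtain ⟨j, hj⟩ := h
    have hjn : j < n := by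
      by_contra! hjn
      have h1 : Finsupp.embDomain Fin.valEmbedding e j = r := by rw [hj, Finsupp.single_eq_same]
      rw [Finsupp.embDomain_of_notMem_range] at h1
      · omega
      · rintro ⟨k, hk⟩
        have := k.2
        simp only [Fin.valEmbedding_apply] at hk
        omega
    rw [sum_eq_single j, if_pos hj]
    · intro i _ hi
      rw [if_neg]
      rw [hj]
      intro h'
      exact hi (Finsupp.single_left_injective hr.ne' h').symm
    · exact fun h' => absurd (mem_range.2 hjn) h'
  · push Not at h
    exact (sum_eq_zero fun i _ => if_neg (h i)).symm

/-- The Murnaghan–Nakayama rule. -/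
theorem schur_mul_powerSum {r : ℕ} (hr : 0 < r) (μ : YoungDiagram) :
    schur μ * powerSum r = ∑ ν ∈ ribbonAdditions μ r, (ribbonSign μ ν : ℚ) • schur ν := by
  ext e
  -- Enough variables both for the finite rule and to see the monomial `e`.
  set n := μ.card + r + (e.support.sup id + 1) with hn
  obtain ⟨e', he'⟩ : e ∈ Set.range (Finsupp.embDomain (Fin.valEmbedding (n := n))) := by
    rw [Finsupp.mem_range_embDomain_iff]
    intro i hi
    have := le_sup (f := id) hi
    simp only [id_eq] at this
    exact ⟨⟨i, by omega⟩, rfl⟩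
  rw [← he', ← MvPowerSeries.coeff_killCompl, ← MvPowerSeries.coeff_killCompl]
  congr 1
  have key := sum_pow_mul_tabSum hr μ (show μ.card + r ≤ n by omega)
    (MvPowerSeries.X : ℕ → MvPowerSeries ℕ ℚ) (fun i _ j _ h => MvPowerSeries.X_inj.1 h)
  rw [map_mul, killCompl_schur, killCompl_powerSum hr, ← map_mul, key, map_sum, map_sum]
  refine sum_congr rfl fun ν _ => ?_
  rw [map_smul, killCompl_schur, map_mul, map_intCast, Algebra.smul_def]
  simp

/-! ### Types and their partitions -/

theorem SplitType.multList_pos (τ : SplitType) (d : ℕ+) : ∀ x ∈ τ.multList d, 0 < x := by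
  intro x hx
  obtain ⟨b, -, rfl⟩ := List.mem_map.1 hx
  exact b.mult.pos

theorem SplitType.rowLens_restr (τ : SplitType) (d : ℕ+) :
    (τ.restr d).rowLens = τ.multList d :=
  YoungDiagram.rowLens_ofRowLens_eq_self (τ.multList_pos d)

theorem SplitType.restr_eq_of_multList {τ : SplitType} {d : ℕ+} {ν : YoungDiagram}
    (h : (τ.multList d).Perm ν.rowLens) : τ.restr d = ν := by
  have h1 := h.eq_of_sortedGE (τ.multList_sorted d) ν.rowLens_sorted
  rw [← YoungDiagram.ofRowLens_to_rowLens_eq_self (μ := ν), SplitType.restr]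
  congr 1

theorem Block.eq_iff (a b : Block) : a = b ↔ a.deg = b.deg ∧ (a.mult : ℕ) = b.mult := by
  rw [PNat.coe_inj]
  exact ⟨fun h => by simp [h], fun h => ofLex.injective (Prod.ext h.1 h.2)⟩

theorem SplitType.count_blocks (τ : SplitType) (b : Block) :
    τ.blocks.count b = (τ.multList b.deg).count (b.mult : ℕ) := by
  rw [SplitType.multList, List.count, List.count, List.countP_map, List.countP_filter]
  refine List.countP_congr fun a _ => ?_
  simp only [beq_iff_eq, Function.comp_apply, Bool.and_eq_true, decide_eq_true_eq]
  rw [Block.eq_iff, and_comm]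

/-- The multiplicity of a block `d^m` in a type is that of the part `m` in its partition of degree
`d`, and sorted lists are determined by their multiplicities. -/
theorem SplitType.ext_restr {σ τ : SplitType} (h : ∀ d, σ.restr d = τ.restr d) : σ = τ := by
  refine SplitType.ext (List.Perm.eq_of_sortedGE σ.sorted τ.sorted ?_)
  rw [List.perm_iff_count]
  intro b
  rw [σ.count_blocks, τ.count_blocks, ← rowLens_restr, ← rowLens_restr, h]

/-- The type obtained by replacing the partition `σ|_k` by `ν`. -/
def SplitType.update (σ : SplitType) (k : ℕ+) (ν : YoungDiagram) : SplitType :=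
  ⟨(σ.blocks.filter (fun b => b.deg ≠ k) ++
      ν.rowLens.map fun l => (toLex (k, l.toPNat') : Block)).mergeSort (· ≥ ·),
    List.sortedGE_mergeSort⟩

theorem SplitType.multList_update (σ : SplitType) (k : ℕ+) (ν : YoungDiagram) (d : ℕ+) :
    ((σ.update k ν).multList d).Perm (if d = k then ν.rowLens else σ.multList d) := by
  have h1 := ((List.mergeSort_perm (σ.blocks.filter (fun b => b.deg ≠ k) ++
      ν.rowLens.map fun l => (toLex (k, l.toPNat') : Block)) (fun a b => decide (a ≥ b))).filter
      (fun b => b.deg = d)).map (fun b => (b.mult : ℕ))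
  refine List.Perm.trans h1 (List.Perm.of_eq ?_)
  rw [List.filter_append, List.filter_filter, List.filter_map, List.map_append, List.map_map]
  split_ifs with h
  · subst h
    rw [List.filter_eq_nil_iff.2, List.filter_eq_self.2, List.map_nil, List.nil_append]
    · conv_rhs => rw [← List.map_id ν.rowLens]
      refine List.map_congr_left fun l hl => ?_
      -- The default value of `toPNat'` at 0 never arises.
      have := ν.pos_of_mem_rowLens l hl
      change ((l.toPNat' : ℕ+) : ℕ) = l
      rw [Nat.toPNat'_coe, if_pos this]
    · intro l _
      simp [Block.deg]
    · intro b _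
      simp
  · have h2 : ν.rowLens.filter
        ((fun b : Block => decide (b.deg = d)) ∘ fun l => toLex (k, l.toPNat')) = [] := by
      rw [List.filter_eq_nil_iff]
      intro l _
      exact fun h3 => h (of_decide_eq_true h3).symm
    rw [h2, List.map_nil, List.append_nil, SplitType.multList]
    congr 1
    refine List.filter_congr fun b _ => ?_
    by_cases hb : b.deg = d
    · simp [hb, h]
    · simp [hb]

theorem SplitType.restr_update (σ : SplitType) (k : ℕ+) (ν : YoungDiagram) :
    (σ.update k ν).restr k = ν :=
  restr_eq_of_multList (by simpa using σ.multList_update k ν k)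

theorem SplitType.restr_update_of_ne (σ : SplitType) {k d : ℕ+} (h : d ≠ k) (ν : YoungDiagram) :
    (σ.update k ν).restr d = σ.restr d := by
  refine restr_eq_of_multList ?_
  have := σ.multList_update k ν d
  rwa [if_neg h, ← rowLens_restr σ d] at this

theorem SplitType.mem_degrees {τ : SplitType} {d : ℕ+} : d ∈ τ.degrees ↔ τ.restr d ≠ ⊥ := by
  have h1 : d ∈ τ.degrees ↔ τ.multList d ≠ [] := by
    rw [degrees, List.mem_toFinset, multList, Ne, List.map_eq_nil_iff, List.filter_eq_nil_iff]
    simp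
  have h2 : (⊥ : YoungDiagram).rowLens = [] := by
    rw [← List.length_eq_zero_iff, YoungDiagram.length_rowLens, YoungDiagram.colLen_eq_card]
    rfl
  rw [h1, ← rowLens_restr, not_iff_not]
  refine ⟨fun h => ?_, fun h => h ▸ h2⟩
  have := YoungDiagram.equivListRowLens.injective (a₁ := τ.restr d) (a₂ := ⊥)
  exact this (Subtype.ext (h.trans h2.symm))

theorem tabCount_bot (e : ℕ →₀ ℕ) : tabCount ⊥ e = if e = 0 then 1 else 0 := by
  have hT : ∀ T T' : SemistandardYoungTableau ⊥, T = T' := fun T T' =>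
    tableau_ext fun c hc => by simp at hc
  split_ifs with h
  · subst h
    have : Unique {T : SemistandardYoungTableau ⊥ // content T = 0} :=
      ⟨⟨⟨default, by simp [content]⟩⟩, fun T => Subtype.ext (hT _ _)⟩
    exact Nat.card_unique
  · exact tabCount_eq_zero _ fun h' => h ((Finsupp.degree_eq_zero_iff e).1 h')

theorem schur_bot : schur ⊥ = 1 := by
  classical
  ext e
  rw [coeff_schur, tabCount_bot, MvPowerSeries.coeff_one]
  simp

/-- Additional degrees contribute `s_∅ = 1`, so several types can be compared over a common set of
degrees. -/
theorem sTensor_eq_prod (τ : SplitType) {S : Finset ℕ+} (h : τ.degrees ⊆ S) :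
    sTensor τ = ∏ d ∈ S, inAlphabet d (schur (τ.restr d)) := by
  refine prod_subset h fun d _ hd => ?_
  rw [SplitType.mem_degrees, not_not] at hd
  rw [hd, schur_bot, inAlphabet, map_one]

/-! ### Linear independence -/

/-- The exponent vector `x_d ^ (ε d)` over all `d ∈ S`. -/
def joinExp (S : Finset ℕ+) (ε : ℕ+ → ℕ →₀ ℕ) : ℕ+ × ℕ →₀ ℕ :=
  ∑ d ∈ S, Finsupp.embDomain (Function.Embedding.sectR d ℕ) (ε d)

theorem embDomain_sectR_apply (d d' : ℕ+) (f : ℕ →₀ ℕ) (j : ℕ) :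
    Finsupp.embDomain (Function.Embedding.sectR d ℕ) f (d', j) = if d = d' then f j else 0 := by
  split_ifs with h
  · subst h
    exact Finsupp.embDomain_apply_self (Function.Embedding.sectR d ℕ) f j
  · refine Finsupp.embDomain_of_notMem_range _ _ _ ?_
    rintro ⟨k, hk⟩
    exact h (congrArg Prod.fst hk)

theorem coeff_inAlphabet (d : ℕ+) (f : MvPowerSeries ℕ ℚ) (e : ℕ →₀ ℕ) :
    MvPowerSeries.coeff (Finsupp.embDomain (Function.Embedding.sectR d ℕ) e) (inAlphabet d f) =
      MvPowerSeries.coeff e f :=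
  MvPowerSeries.coeff_embDomain_rename _ _ _

theorem coeff_inAlphabet_eq_zero (d : ℕ+) (f : MvPowerSeries ℕ ℚ) {e : ℕ+ × ℕ →₀ ℕ}
    (h : ∀ e', Finsupp.embDomain (Function.Embedding.sectR d ℕ) e' ≠ e) :
    MvPowerSeries.coeff e (inAlphabet d f) = 0 := by
  refine MvPowerSeries.coeff_rename_eq_zero _ _ ?_
  rintro ⟨e', he'⟩
  exact h e' (by rw [Finsupp.embDomain_eq_mapDomain]; exact he')

/-- The alphabets are disjoint, so among all ways to split the exponent vector over the factors only
the one by degree contributes. -/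
theorem coeff_joinExp (S : Finset ℕ+) (ε : ℕ+ → ℕ →₀ ℕ) (f : ℕ+ → MvPowerSeries ℕ ℚ) :
    MvPowerSeries.coeff (joinExp S ε) (∏ d ∈ S, inAlphabet d (f d)) =
      ∏ d ∈ S, MvPowerSeries.coeff (ε d) (f d) := by
  classical
  rw [MvPowerSeries.coeff_prod]
  let l₀ : ℕ+ →₀ ℕ+ × ℕ →₀ ℕ := Finsupp.onFinset S
    (fun d => if d ∈ S then Finsupp.embDomain (Function.Embedding.sectR d ℕ) (ε d) else 0)
    (fun d h => by by_contra hd; simp [hd] at h)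
  have hl₀ : ∀ d ∈ S, l₀ d = Finsupp.embDomain (Function.Embedding.sectR d ℕ) (ε d) :=
    fun d hd => if_pos hd
  rw [sum_eq_single l₀]
  · exact prod_congr rfl fun d hd => by rw [hl₀ d hd, coeff_inAlphabet]
  · intro l hl hne
    rw [mem_finsuppAntidiag] at hl
    by_contra hprod
    rw [← ne_eq, prod_ne_zero_iff] at hprod
    have hemb : ∀ d ∈ S, ∃ e', Finsupp.embDomain (Function.Embedding.sectR d ℕ) e' = l d := by
      intro d hd
      by_contra! h
      exact hprod d hd (coeff_inAlphabet_eq_zero d _ h)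
    refine hne (Finsupp.ext fun d => ?_)
    by_cases hd : d ∈ S
    · rw [hl₀ d hd]
      obtain ⟨e', he'⟩ := hemb d hd
      rw [← he']
      congr 1
      ext j
      have h1 := DFunLike.congr_fun hl.1 (d, j)
      rw [joinExp, Finsupp.finsetSum_apply, Finsupp.finsetSum_apply, sum_eq_single d,
        sum_eq_single d, ← he', embDomain_sectR_apply, embDomain_sectR_apply, if_pos rfl,
        if_pos rfl] at h1
      · exact h1
      · intro d' _ h'
        rw [embDomain_sectR_apply, if_neg h']
      · exact fun h => absurd hd h
      · intro d' hd' h'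
        obtain ⟨e'', he''⟩ := hemb d' hd'
        rw [← he'', embDomain_sectR_apply, if_neg h']
      · exact fun h => absurd hd h
    · have h1 : d ∉ l.support := fun h => hd (hl.2 h)
      have h2 : d ∉ l₀.support := fun h => hd (Finsupp.support_onFinset_subset h)
      rw [Finsupp.notMem_support_iff.1 h1, Finsupp.notMem_support_iff.1 h2]
  · intro h
    refine absurd (mem_finsuppAntidiag.2 ⟨?_, Finsupp.support_onFinset_subset⟩) h
    exact sum_congr rfl hl₀

/-- The row lengths of a diagram. -/
def rowContent (lam : YoungDiagram) : ℕ →₀ ℕ := content (SemistandardYoungTableau.highestWeight lam)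

theorem rowContent_apply (lam : YoungDiagram) (i : ℕ) : rowContent lam i = lam.rowLen i := by
  rw [rowContent, content_apply, YoungDiagram.rowLen_eq_card]
  congr 1
  refine filter_congr fun c hc => ?_
  rw [SemistandardYoungTableau.highestWeight_apply, if_pos (show (c.1, c.2) ∈ lam from hc)]

theorem finite_content_eq (lam : YoungDiagram) (e : ℕ →₀ ℕ) :
    Finite {T : SemistandardYoungTableau lam // content T = e} := by
  have hb : ∀ T : {T : SemistandardYoungTableau lam // content T = e}, ∀ c ∈ lam.cells,
      T.1 c.1 c.2 < e.support.sup id + 1 := by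
    intro T c hc
    have h1 : T.1 c.1 c.2 ∈ e.support := by
      rw [Finsupp.mem_support_iff, ← DFunLike.congr_fun T.2, content_apply]
      exact card_ne_zero_of_mem (mem_filter.2 ⟨hc, rfl⟩)
    have := le_sup (f := id) h1
    simp only [id_eq] at this
    omega
  exact Finite.of_injective (fun T => (⟨T.1, hb T⟩ : BoundedTableau lam _)) fun T T' h =>
    Subtype.ext (Subtype.mk.inj h)

/-- The highest weight tableau is counted. Finiteness is needed because `Nat.card` of an infinite
type is 0. -/
theorem tabCount_rowContent_ne_zero (lam : YoungDiagram) : tabCount lam (rowContent lam) ≠ 0 := by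
  have := finite_content_eq lam (rowContent lam)
  have : Nonempty {T : SemistandardYoungTableau lam // content T = rowContent lam} := ⟨⟨_, rfl⟩⟩
  exact Nat.card_pos.ne'

/-- Entries below `k` lie in the first `k` rows. -/
theorem sum_content_le {lam : YoungDiagram} (T : SemistandardYoungTableau lam) (k : ℕ) :
    ∑ i ∈ range k, content T i ≤ ∑ i ∈ range k, lam.rowLen i := by
  have h1 : ∑ i ∈ range k, content T i = #{c ∈ lam.cells | T c.1 c.2 < k} := by
    rw [card_eq_sum_card_fiberwise (f := fun c => T c.1 c.2) (t := range k)]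
    · refine sum_congr rfl fun i hi => ?_
      rw [content_apply, filter_filter]
      congr 1
      refine filter_congr fun c _ => ?_
      rw [mem_range] at hi
      omega
    · intro c hc
      simpa using (mem_filter.1 hc).2
  have h2 : ∑ i ∈ range k, lam.rowLen i = #{c ∈ lam.cells | c.1 < k} := by
    rw [card_eq_sum_card_fiberwise (f := Prod.fst) (t := range k)]
    · refine sum_congr rfl fun i hi => ?_
      rw [YoungDiagram.rowLen_eq_card, YoungDiagram.row, filter_filter]
      congr 1
      refine filter_congr fun c _ => ?_
      rw [mem_range] at hi
      omega
    · intro c hc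
      simpa using (mem_filter.1 hc).2
  rw [h1, h2]
  refine card_le_card fun c hc => ?_
  rw [mem_filter] at hc ⊢
  exact ⟨hc.1, (le_tableau_apply T c.1 c.2 hc.1).trans_lt hc.2⟩

/-- The partial sums of the row lengths of the partitions of a type. -/
def SplitType.dominance (τ : SplitType) (d : ℕ+) (k : ℕ) : ℕ :=
  ∑ i ∈ range k, (τ.restr d).rowLen i

theorem SplitType.dominance_injective : Function.Injective SplitType.dominance := by
  intro σ τ h
  refine SplitType.ext_restr fun d => ext_rowLen fun i => ?_
  have h1 := congrFun (congrFun h d) i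
  have h2 := congrFun (congrFun h d) (i + 1)
  simp only [dominance, sum_range_succ] at h1 h2
  omega

theorem coeff_sTensor (σ τ : SplitType) {S : Finset ℕ+} (hσ : σ.degrees ⊆ S) :
    MvPowerSeries.coeff (joinExp S fun d => rowContent (τ.restr d)) (sTensor σ) =
      ∏ d ∈ S, (tabCount (σ.restr d) (rowContent (τ.restr d)) : ℚ) := by
  rw [sTensor_eq_prod σ hσ, coeff_joinExp]
  simp only [coeff_schur]

theorem dominance_le_of_coeff_ne_zero {σ τ : SplitType} {S : Finset ℕ+} (hσ : σ.degrees ⊆ S)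
    (hτ : τ.degrees ⊆ S)
    (h : MvPowerSeries.coeff (joinExp S fun d => rowContent (τ.restr d)) (sTensor σ) ≠ 0) :
    τ.dominance ≤ σ.dominance := by
  rw [coeff_sTensor σ τ hσ, prod_ne_zero_iff] at h
  intro d k
  by_cases hd : d ∈ S
  · have h1 := h d hd
    rw [Nat.cast_ne_zero] at h1
    obtain ⟨⟨T, hT⟩⟩ := (Nat.card_ne_zero.1 h1).1
    have h2 := sum_content_le T k
    rw [hT] at h2
    simp only [rowContent_apply] at h2
    exact h2
  · have h1 : σ.restr d = ⊥ := by
      by_contra h'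
      exact hd (hσ (SplitType.mem_degrees.2 h'))
    have h2 : τ.restr d = ⊥ := by
      by_contra h'
      exact hd (hτ (SplitType.mem_degrees.2 h'))
    rw [SplitType.dominance, SplitType.dominance, h1, h2]

/-- In a vanishing combination, choose `τ` maximal for dominance among the types with nonzero
coefficient. The monomial of `τ` then occurs in no other term, but does occur in `s⊗_τ`. -/
theorem linearIndependent_sTensor : LinearIndependent ℚ sTensor := by
  classical
  rw [linearIndependent_iff']
  intro s g hg
  by_contra! hne
  obtain ⟨τ₀, hτ₀, hgτ₀⟩ := hne
  obtain ⟨τ, hτ, hmax⟩ := Finset.exists_maximalFor SplitType.dominance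
    (s.filter fun τ => g τ ≠ 0) ⟨τ₀, mem_filter.2 ⟨hτ₀, hgτ₀⟩⟩
  rw [mem_filter] at hτ
  have hS : ∀ σ ∈ s, σ.degrees ⊆ s.biUnion SplitType.degrees := fun σ hσ =>
    subset_biUnion_of_mem _ hσ
  have h := congrArg (MvPowerSeries.coeff
    (joinExp (s.biUnion SplitType.degrees) fun d => rowContent (τ.restr d))) hg
  rw [map_sum, map_zero, sum_eq_single τ, map_smul, smul_eq_mul, coeff_sTensor τ τ (hS τ hτ.1)] at h
  · refine mul_ne_zero hτ.2 (prod_ne_zero_iff.2 fun d _ => ?_) h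
    exact Nat.cast_ne_zero.2 (tabCount_rowContent_ne_zero _)
  · intro σ hσ hne
    rw [map_smul, smul_eq_mul]
    by_contra h0
    rw [← ne_eq, mul_ne_zero_iff] at h0
    have h1 := dominance_le_of_coeff_ne_zero (hS σ hσ) (hS τ hτ.1) h0.2
    have h2 := hmax (mem_filter.2 ⟨hσ, h0.1⟩) h1
    exact hne (SplitType.dominance_injective (le_antisymm h2 h1))
  · exact fun h' => absurd hτ.1 h'

/-! ### The product with `P_{d^m}` -/

theorem coeff_inAlphabet_powerSum (k : ℕ+) (r : ℕ) (e : ℕ+ × ℕ →₀ ℕ) :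
    MvPowerSeries.coeff e (inAlphabet k (powerSum r)) =
      open Classical in if ∃ j : ℕ, e = Finsupp.single (k, j) r then 1 else 0 := by
  classical
  by_cases h : ∃ e', Finsupp.embDomain (Function.Embedding.sectR k ℕ) e' = e
  · obtain ⟨e', rfl⟩ := h
    rw [coeff_inAlphabet, coeff_powerSum]
    refine if_congr (exists_congr fun j => ?_) rfl rfl
    have : Finsupp.single (k, j) r =
        Finsupp.embDomain (Function.Embedding.sectR k ℕ) (Finsupp.single j r) := by
      rw [Finsupp.embDomain_single]
      rfl
    rw [this, (Finsupp.embDomain_injective _).eq_iff]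
  · push Not at h
    rw [coeff_inAlphabet_eq_zero k _ h, if_neg]
    rintro ⟨j, rfl⟩
    refine h (Finsupp.single j r) ?_
    rw [Finsupp.embDomain_single]
    rfl

theorem expand_inAlphabet_powerSum (k : ℕ+) (r m : ℕ) (hm : m ≠ 0) :
    MvPowerSeries.expand m hm (inAlphabet k (powerSum r)) = inAlphabet k (powerSum (r * m)) := by
  classical
  ext e
  rw [coeff_inAlphabet_powerSum]
  by_cases h : ∀ i, m ∣ e i
  · obtain ⟨e', rfl⟩ : ∃ e', e = m • e' := by
      refine ⟨e.mapRange (fun a => a / m) (Nat.zero_div m), Finsupp.ext fun i => ?_⟩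
      simp [Nat.mul_div_cancel' (h i)]
    rw [MvPowerSeries.coeff_expand_smul, coeff_inAlphabet_powerSum]
    refine if_congr (exists_congr fun j => ?_) rfl rfl
    have h1 : Finsupp.single (k, j) (r * m) = m • Finsupp.single (k, j) r := by
      rw [Finsupp.smul_single, smul_eq_mul, mul_comm]
    rw [h1, (smul_right_injective _ hm).eq_iff]
  · push Not at h
    obtain ⟨i, hi⟩ := h
    rw [MvPowerSeries.coeff_expand_of_not_dvd m hm _ hi, if_neg]
    rintro ⟨j, rfl⟩
    refine hi ?_
    rw [Finsupp.single_apply]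
    split_ifs
    · exact dvd_mul_left m r
    · exact dvd_zero m

/-- The positions where a ribbon can be added for the block `b`. -/
def positions (b : Block) : Finset ℕ+ :=
  open Classical in {k ∈ Finset.Icc 1 b.deg | k ∣ b.deg}

theorem mem_positions {b : Block} {k : ℕ+} : k ∈ positions b ↔ k ∣ b.deg := by
  classical
  rw [positions, mem_filter, mem_Icc]
  exact ⟨fun h => h.2, fun h => ⟨⟨one_le, PNat.le_of_dvd h⟩, h⟩⟩

theorem polyPBlock_eq (b : Block) : polyPBlock b =
    ∑ k ∈ positions b, (k : ℚ) • inAlphabet k (powerSum (b.weight / k)) := by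
  rw [polyPBlock, polyP, map_sum]
  refine sum_congr rfl fun k hk => ?_
  have hk' : (k : ℕ) ∣ b.deg := PNat.dvd_iff.1 (mem_positions.1 hk)
  rw [map_smul, expand_inAlphabet_powerSum, Block.weight, Nat.div_mul_right_comm hk']

theorem SplitType.degrees_update_subset (σ : SplitType) (k : ℕ+) (ν : YoungDiagram) :
    (σ.update k ν).degrees ⊆ insert k σ.degrees := by
  intro d hd
  rw [mem_degrees] at hd
  rw [mem_insert, mem_degrees]
  by_cases h : d = k
  · exact Or.inl h
  · rw [σ.restr_update_of_ne h] at hd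
    exact Or.inr hd

/-- Only the factor in the alphabet `k` is affected; the Murnaghan–Nakayama rule expands it. -/
theorem sTensor_mul_inAlphabet_powerSum (σ : SplitType) (k : ℕ+) {r : ℕ} (hr : 0 < r) :
    sTensor σ * inAlphabet k (powerSum r) =
      ∑ ν ∈ ribbonAdditions (σ.restr k) r,
        (ribbonSign (σ.restr k) ν : ℚ) • sTensor (σ.update k ν) := by
  have hk : k ∈ insert k σ.degrees := mem_insert_self _ _
  have key : sTensor σ * inAlphabet k (powerSum r) =
      inAlphabet k (schur (σ.restr k) * powerSum r) *
        ∏ d ∈ (insert k σ.degrees).erase k, inAlphabet d (schur (σ.restr d)) := by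
    rw [sTensor_eq_prod σ (subset_insert k _), ← mul_prod_erase _ _ hk, mul_right_comm]
    congr 1
    simp only [inAlphabet, map_mul]
  rw [key, schur_mul_powerSum hr, inAlphabet, map_sum, sum_mul]
  refine sum_congr rfl fun ν _ => ?_
  rw [map_smul, smul_mul_assoc, sTensor_eq_prod _ (σ.degrees_update_subset k ν),
    ← mul_prod_erase _ _ hk, σ.restr_update]
  congr 2
  refine prod_congr rfl fun d hd => ?_
  rw [σ.restr_update_of_ne (mem_erase.1 hd).1]

/-- The coefficient of `s⊗_τ` in `s⊗_σ P_{d^m}`. -/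
def blockCoeff (σ τ : SplitType) (b : Block) : ℚ :=
  ∑ R : RibbonAddition σ τ b, ((R.sgn * R.wt : ℤ) : ℚ)

/-- The addition of a ribbon at a given position. -/
def addRibbon {σ : SplitType} {b : Block} {k : ℕ+} {ν : YoungDiagram} (hk : k ∣ b.deg)
    (hν : IsRibbon (b.weight / k) (σ.restr k) ν) : RibbonAddition σ (σ.update k ν) b :=
  ⟨k, hk, by rwa [σ.restr_update], fun _ h => σ.restr_update_of_ne h ν⟩

theorem RibbonAddition.eq_update {σ τ : SplitType} {b : Block} (R : RibbonAddition σ τ b) :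
    τ = σ.update R.pos (τ.restr R.pos) := by
  refine SplitType.ext_restr fun d => ?_
  by_cases h : d = R.pos
  · rw [h, σ.restr_update]
  · rw [σ.restr_update_of_ne h, R.same d h]

/-- The positions and shapes of the ribbons that can be added to `σ` for the block `b`. -/
def ribbonChoices (σ : SplitType) (b : Block) : Finset (Σ _ : ℕ+, YoungDiagram) :=
  (positions b).sigma fun k => ribbonAdditions (σ.restr k) (b.weight / k)

theorem mem_ribbonChoices {σ : SplitType} {b : Block} {x : Σ _ : ℕ+, YoungDiagram} :
    x ∈ ribbonChoices σ b ↔ x.1 ∣ b.deg ∧ IsRibbon (b.weight / x.1) (σ.restr x.1) x.2 := by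
  rw [ribbonChoices, mem_sigma, mem_positions, mem_ribbonAdditions]

/-- The types that arise from `σ` by adding a ribbon for the block `b`. -/
def typeAdditions (σ : SplitType) (b : Block) : Finset SplitType :=
  open Classical in (ribbonChoices σ b).image fun x => σ.update x.1 x.2

theorem mem_typeAdditions {σ τ : SplitType} {b : Block} :
    τ ∈ typeAdditions σ b ↔ Nonempty (RibbonAddition σ τ b) := by
  classical
  rw [typeAdditions, mem_image]
  constructor
  · rintro ⟨x, hx, rfl⟩
    rw [mem_ribbonChoices] at hx
    exact ⟨addRibbon hx.1 hx.2⟩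
  · rintro ⟨R⟩
    exact ⟨⟨R.pos, τ.restr R.pos⟩, mem_ribbonChoices.2 ⟨R.dvd, R.ribbon⟩, R.eq_update.symm⟩

/-- The position of a ribbon is determined by the two types, so no two choices of position and shape
give the same type. -/
theorem injOn_update (σ : SplitType) (b : Block) :
    Set.InjOn (fun x : Σ _ : ℕ+, YoungDiagram => σ.update x.1 x.2) (ribbonChoices σ b) := by
  rintro ⟨k, ν⟩ hx ⟨k', ν'⟩ hx' h
  rw [mem_coe, mem_ribbonChoices] at hx hx'
  dsimp only at h hx hx'
  have h1 : ∀ {τ τ' : SplitType} (R : RibbonAddition σ τ b) (R' : RibbonAddition σ τ' b),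
      τ = τ' → R.pos = R'.pos := by
    rintro τ _ R R' rfl
    rw [Subsingleton.elim R R']
  obtain rfl : k = k' := h1 (addRibbon hx.1 hx.2) (addRibbon hx'.1 hx'.2) h
  have h2 := congrArg (fun τ : SplitType => τ.restr k) h
  simp only [σ.restr_update] at h2
  rw [h2]

theorem sTensor_mul_polyPBlock (σ : SplitType) (b : Block) :
    sTensor σ * polyPBlock b = ∑ τ ∈ typeAdditions σ b, blockCoeff σ τ b • sTensor τ := by
  classical
  rw [typeAdditions, sum_image (injOn_update σ b), ribbonChoices, sum_sigma, polyPBlock_eq, mul_sum]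
  refine sum_congr rfl fun k hk => ?_
  rw [mem_positions] at hk
  rw [mul_smul_comm, sTensor_mul_inAlphabet_powerSum σ k (Block.weight_div_pos hk), smul_sum]
  refine sum_congr rfl fun ν hν => ?_
  rw [mem_ribbonAdditions] at hν
  rw [smul_smul, blockCoeff, Fintype.sum_subsingleton _ (addRibbon hk hν), RibbonAddition.sgn,
    RibbonAddition.wt]
  congr 1
  have hpos : (addRibbon hk hν : RibbonAddition σ (σ.update k ν) b).pos = k := rfl
  rw [hpos, σ.restr_update]
  push_cast
  ring

/-! ### The product with `P_δ` -/

/-- The coefficient of `s⊗_τ` in `s⊗_σ P_δ`. -/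
def seqCoeff (σ τ : SplitType) (δ : List Block) : ℚ :=
  ∑ T : TRHT σ τ δ, ((T.sgn * T.wt : ℤ) : ℚ)

theorem seqCoeff_eq_zero {σ τ : SplitType} {δ : List Block} (h : ¬ Nonempty (TRHT σ τ δ)) :
    seqCoeff σ τ δ = 0 := by
  rw [not_nonempty_iff] at h
  exact Fintype.sum_empty _

theorem seqCoeff_nil_self (σ : SplitType) : seqCoeff σ σ [] = 1 := by
  have : Subsingleton (TRHT σ σ []) := ⟨fun T T' => by cases T; cases T'; rfl⟩
  rw [seqCoeff, Fintype.sum_subsingleton _ (TRHT.nil σ)]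
  simp [TRHT.sgn, TRHT.wt]

/-- A tensor rim hook tableau consists of its first ribbon and the rest. -/
def trhtConsEquiv (σ τ : SplitType) (b : Block) (δ : List Block) :
    (Σ ρ : typeAdditions σ b, RibbonAddition σ ρ b × TRHT ρ τ δ) ≃ TRHT σ τ (b :: δ) where
  toFun x := .cons x.2.1 x.2.2
  invFun T := match T with
    | .cons R T => ⟨⟨_, mem_typeAdditions.2 ⟨R⟩⟩, R, T⟩
  left_inv _ := rfl
  right_inv T := by cases T; rfl

theorem seqCoeff_cons (σ τ : SplitType) (b : Block) (δ : List Block) :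
    seqCoeff σ τ (b :: δ) = ∑ ρ ∈ typeAdditions σ b, blockCoeff σ ρ b * seqCoeff ρ τ δ := by
  rw [seqCoeff, ← Equiv.sum_comp (trhtConsEquiv σ τ b δ), Fintype.sum_sigma,
    ← sum_coe_sort (typeAdditions σ b)]
  refine sum_congr rfl fun ρ _ => ?_
  rw [blockCoeff, seqCoeff, sum_mul_sum, Fintype.sum_prod_type]
  refine sum_congr rfl fun R _ => sum_congr rfl fun T _ => ?_
  simp only [trhtConsEquiv, Equiv.coe_fn_mk, TRHT.sgn, TRHT.wt]
  push_cast
  ring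

theorem finite_trht (σ : SplitType) (δ : List Block) : {τ | Nonempty (TRHT σ τ δ)}.Finite := by
  induction δ generalizing σ with
  | nil =>
    refine (Set.finite_singleton σ).subset ?_
    rintro τ ⟨T⟩
    cases T
    rfl
  | cons b δ ih =>
    refine ((typeAdditions σ b).finite_toSet.biUnion fun ρ _ => ih ρ).subset ?_
    rintro τ ⟨T⟩
    cases T with
    | cons R T =>
      simp only [Set.mem_iUnion]
      exact ⟨_, mem_coe.2 (mem_typeAdditions.2 ⟨R⟩), ⟨T⟩⟩

/-- Allowing any finite `V` that contains all reachable types lets one `V` serve for every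
intermediate type in the induction. -/
theorem sTensor_mul_polyPSeq (σ : SplitType) (δ : List Block) {V : Finset SplitType}
    (hV : ∀ τ, Nonempty (TRHT σ τ δ) → τ ∈ V) :
    sTensor σ * polyPSeq δ = ∑ τ ∈ V, seqCoeff σ τ δ • sTensor τ := by
  classical
  induction δ generalizing σ with
  | nil =>
    rw [sum_eq_single σ, seqCoeff_nil_self, one_smul, polyPSeq, List.map_nil, List.prod_nil, mul_one]
    · intro τ _ hτ
      rw [seqCoeff_eq_zero, zero_smul]
      rintro ⟨T⟩
      cases T
      exact hτ rfl
    · exact fun h => absurd (hV σ ⟨TRHT.nil σ⟩) h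
  | cons b δ ih =>
    have h1 : polyPSeq (b :: δ) = polyPBlock b * polyPSeq δ := by
      rw [polyPSeq, List.map_cons, List.prod_cons, polyPSeq]
    rw [h1, ← mul_assoc, sTensor_mul_polyPBlock, sum_mul]
    simp only [seqCoeff_cons, sum_smul]
    rw [sum_comm]
    refine sum_congr rfl fun ρ hρ => ?_
    obtain ⟨R⟩ := mem_typeAdditions.1 hρ
    rw [smul_mul_assoc, ih ρ fun τ ⟨T⟩ => hV τ ⟨TRHT.cons R T⟩, smul_sum]
    simp only [smul_smul]

/-! ### Weights and the transition matrix -/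

/-- At position `k` the ribbon has `d * m / k` cells, each of weight `k`, and `k ∣ d` makes the
division exact. -/
theorem RibbonAddition.weight_eq {σ τ : SplitType} {b : Block} (R : RibbonAddition σ τ b) :
    τ.weight = σ.weight + b.weight := by
  have h1 := σ.weight_eq (insert R.pos (σ.degrees ∪ τ.degrees))
    (subset_union_left.trans (subset_insert _ _))
  have h2 := τ.weight_eq (insert R.pos (σ.degrees ∪ τ.degrees))
    (subset_union_right.trans (subset_insert _ _))
  rw [← add_sum_erase _ _ (mem_insert_self _ _)] at h1 h2
  have h3 : ∀ d ∈ (insert R.pos (σ.degrees ∪ τ.degrees)).erase R.pos,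
      (d : ℕ) * (τ.restr d).card = d * (σ.restr d).card := fun d hd => by
    rw [R.same d (mem_erase.1 hd).1]
  have h4 : (R.pos : ℕ) ∣ b.weight := (PNat.dvd_iff.1 R.dvd).mul_right _
  rw [h2, h1, sum_congr rfl h3, R.ribbon.card_add, mul_add, Nat.mul_div_cancel' h4]
  ring

theorem TRHT.weight_eq {σ τ : SplitType} {δ : List Block} (T : TRHT σ τ δ) :
    τ.weight = σ.weight + (δ.map Block.weight).sum := by
  induction T with
  | nil => simp
  | cons R T ih =>
    rw [ih, R.weight_eq, List.map_cons, List.sum_cons, add_assoc]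

theorem sTensor_empty : sTensor SplitType.empty = 1 := by
  rw [sTensor, SplitType.degrees, SplitType.empty, List.map_nil, List.toFinset_nil, prod_empty]

theorem polyPSeq_eq_sum (n : ℕ) (σ : TypesOf n) : polyPSeq σ.1.blocks =
    ∑ τ : TypesOf n, seqCoeff SplitType.empty τ σ.1.blocks • sTensor τ := by
  classical
  have h := sTensor_mul_polyPSeq SplitType.empty σ.1.blocks
    (V := univ.map (Function.Embedding.subtype fun τ : SplitType => τ.weight = n)) (by
      rintro τ ⟨T⟩
      rw [mem_map]
      refine ⟨⟨τ, ?_⟩, mem_univ _, rfl⟩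
      rw [T.weight_eq]
      have : SplitType.empty.weight = 0 := rfl
      rw [this, zero_add]
      exact σ.2)
  rw [sTensor_empty, one_mul, sum_map] at h
  exact h

theorem isTransitionMatrix_seqCoeff (n : ℕ) : IsTransitionMatrix n
    (fun σ => polyPSeq σ.blocks) sTensor
    (fun τ σ => seqCoeff SplitType.empty τ σ.1.blocks) := by
  refine ⟨polyPSeq_eq_sum n, fun M' hM' => ?_⟩
  have hli : LinearIndependent ℚ fun τ : TypesOf n => sTensor τ :=
    linearIndependent_sTensor.comp _ Subtype.val_injective
  ext τ σ
  have h : ∑ τ : TypesOf n, (M' τ σ - seqCoeff SplitType.empty τ σ.1.blocks) • sTensor τ = 0 := by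
    simp only [sub_smul, sum_sub_distrib]
    rw [← polyPSeq_eq_sum n σ, ← hM' σ, sub_self]
  exact sub_eq_zero.1 (Fintype.linearIndependent_iff.1 hli _ h τ)

/-! ### The expansions as sums over all types -/

theorem finite_ribbonAddition (σ : SplitType) (b : Block) :
    {τ | Nonempty (RibbonAddition σ τ b)}.Finite :=
  (typeAdditions σ b).finite_toSet.subset fun _ h => mem_coe.2 (mem_typeAdditions.2 h)

theorem sTensor_mul_polyPBlock_eq_finsum (σ : SplitType) (b : Block) :
    sTensor σ * polyPBlock b = ∑ᶠ τ : SplitType, ∑ R : RibbonAddition σ τ b,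
      ((R.sgn * R.wt : ℤ) : ℚ) • sTensor τ := by
  simp only [← sum_smul]
  rw [sTensor_mul_polyPBlock]
  refine (finsum_eq_sum_of_support_subset (fun τ => blockCoeff σ τ b • sTensor τ) ?_).symm
  intro τ hτ
  refine mem_coe.2 (mem_typeAdditions.2 (not_isEmpty_iff.1 fun h => hτ ?_))
  dsimp only
  rw [blockCoeff, Fintype.sum_empty, zero_smul]

theorem sTensor_mul_polyPSeq_eq_finsum (σ : SplitType) (δ : List Block) :
    sTensor σ * polyPSeq δ = ∑ᶠ τ : SplitType,
      (∑ T : TRHT σ τ δ, ((T.sgn * T.wt : ℤ) : ℚ)) • sTensor τ := by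
  rw [sTensor_mul_polyPSeq σ δ (V := (finite_trht σ δ).toFinset) (by simp)]
  refine (finsum_eq_sum_of_support_subset (fun τ => seqCoeff σ τ δ • sTensor τ) ?_).symm
  intro τ hτ
  rw [Set.Finite.coe_toFinset]
  by_contra h
  refine hτ ?_
  dsimp only
  rw [seqCoeff_eq_zero h, zero_smul]

end Polysym

end

theorem mainTheorem1 :
    -- the `s⊗_τ` are linearly independent, so that `s⊗`-expansions are unique
    LinearIndependent ℚ Polysym.sTensor ∧
    -- the expansion of `s⊗_σ P_{d^m}`
    (∀ (σ : Polysym.SplitType) (b : Polysym.Block),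
      {τ : Polysym.SplitType | Nonempty (Polysym.RibbonAddition σ τ b)}.Finite ∧
      Polysym.sTensor σ * Polysym.polyPBlock b =
        ∑ᶠ τ : Polysym.SplitType, ∑ R : Polysym.RibbonAddition σ τ b,
          ((R.sgn * R.wt : ℤ) : ℚ) • Polysym.sTensor τ) ∧
    -- the expansion of `s⊗_σ P_δ`
    (∀ (σ : Polysym.SplitType) (δ : List Polysym.Block),
      {τ : Polysym.SplitType | Nonempty (Polysym.TRHT σ τ δ)}.Finite ∧
      Polysym.sTensor σ * Polysym.polyPSeq δ =
        ∑ᶠ τ : Polysym.SplitType,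
          (∑ T : Polysym.TRHT σ τ δ, ((T.sgn * T.wt : ℤ) : ℚ)) • Polysym.sTensor τ) ∧
    -- the transition matrix `M(P, s⊗)`
    (∀ n : ℕ, Polysym.IsTransitionMatrix n
      (fun σ => Polysym.polyPSeq σ.blocks) Polysym.sTensor
      (fun τ σ => ∑ T : Polysym.TRHT Polysym.SplitType.empty τ σ.1.blocks,
        ((T.sgn * T.wt : ℤ) : ℚ))) :=
  ⟨Polysym.linearIndependent_sTensor,
    fun σ b => ⟨Polysym.finite_ribbonAddition σ b,
      Polysym.sTensor_mul_polyPBlock_eq_finsum σ b⟩,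
    fun σ δ => ⟨Polysym.finite_trht σ δ, Polysym.sTensor_mul_polyPSeq_eq_finsum σ δ⟩,
    Polysym.isTransitionMatrix_seqCoeff⟩
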